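/- Fix $M\in[-\infty,+\infty]$. A \emph{filtered set} $\mathbb X=(X,F_X)$ is a finite set $X$ with a function $F_X$ from the nonempty subsets of $X$ to $(-\infty,M]$ that is monotone for inclusion. A \emph{relative filtered set} $(\mathbb X,\mathbb A)$ consists of filtered sets $\mathbb X,\mathbb A$ with $A\subseteq X$ and $F_A(\sigma)\ge F_X(\sigma)$ for all $\emptyset\ne\sigma\subseteq A$; we write $\mathbb X$ for $(\mathbb X,\emptyset)$. A map $f\colon X\to Y$ is a \emph{filtration preserving map} $\mathbb X\to\mathbb Y$ if $F_X(\sigma)\ge F_Y(f(\sigma))$ for all $\emptyset\neq\sigma\subseteq X$; a filtration preserving map $(\mathbb X,\mathbb A)\to(\mathbb Y,\mathbb B)$ is such a map with $f(A)\subseteq B$ for which $f|_A\colon\mathbb A\to\mathbb B$ is also filtration preserving. The union $\mathbb X\cup\mathbb Y$ is the set $X\cup Y$ with the filtration that sends $\sigma$ to $\min\{F_X(\sigma),F_Y(\sigma)\}$ if $\sigma\subseteq X\cap Y$, to $F_X(\sigma)$ if $\sigma\subseteq X$ and $\sigma\not\subseteq Y$, to $F_Y(\sigma)$ if $\sigma\subseteq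 Y$ and $\sigma\not\subseteq X$, and to $M$ otherwise. The intersection $\mathbb X\cap\mathbb Y$ is the set $X\cap Y$ with the filtration $\max\{F_X,F_Y\}$. A \emph{$(q,\alpha)$-simplex} ($q\ge 0$, $\alpha\in(-\infty,M]$) is a filtered set with $q+1$ points whose filtration is constantly $\alpha$. Let $\mathscr{RF}$ be the category whose objects are the pairs $((\mathbb X,\mathbb A);I)$ of a relative filtered set and an interval $I=[\varepsilon,\varepsilon']$, with $\varepsilon,\varepsilon'\in\mathbb R$, $0\le\varepsilon\le\varepsilon'\le M$ and $\varepsilon<M$; there are no morphisms $((\mathbb X,\mathbb A);I)\to((\mathbb Y,\mathbb B);J)$ if $I\ne J$, and for $I=J$ the morphisms are the filtration preserving maps $(\mathbb X,\mathbb A)\to(\mathbb Y,\mathbb B)$. \textbf{Theorem.} There is a pair $(\mathrm H,\partial)$, unique up to isomorphism (natural isomorphisms in every degree that commute with $\partial$), where $\mathrm H=(\mathrm H_n)_{n\in\mathbb Z}$, $((\mathbb X,\mathbb A);I)\mapsto \mathrm H^I_n(\mathbb X,\mathbb A)$, is a functor from $\mathscr{RF}$ to $\mathbb Z$-graded abelian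 groups and $\partial\colon\mathrm H^I_n(\mathbb X,\mathbb A)\to\mathrm H^I_{n-1}(\mathbb A,\emptyset)$ is a natural transformation of degree $-1$, that satisfies the following axioms for every $I=[\varepsilon,\varepsilon']$: 1. For all filtered sets $\mathbb X,\mathbb Y$, the inclusion $(\mathbb X,\mathbb X\cap\mathbb Y)\hookrightarrow(\mathbb X\cup\mathbb Y,\mathbb Y)$ induces an isomorphism $\mathrm H^I_n(\mathbb X,\mathbb X\cap\mathbb Y)\to\mathrm H^I_n(\mathbb X\cup\mathbb Y,\mathbb Y)$ for every $n$. 2. For every relative filtered set $(\mathbb X,\mathbb A)$ with inclusions $i\colon\mathbb A\hookrightarrow\mathbb X$ and $j\colon(\mathbb X,\emptyset)\hookrightarrow(\mathbb X,\mathbb A)$, the triangle $\mathrm H^I(\mathbb A)\xrightarrow{i_*}\mathrm H^I(\mathbb X)\xrightarrow{j_*}\mathrm H^I(\mathbb X,\mathbb A)\xrightarrow{\partial}\mathrm H^I(\mathbb A)$ is exact, that is, the long sequence $\cdots\to\mathrm H^I_n(\mathbb A)\to\mathrm H^I_n(\mathbb X)\to\mathrm H^I_n(\mathbb X,\mathbb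 A)\to\mathrm H^I_{n-1}(\mathbb A)\to\cdots$ is exact. 3. For every $(q,\alpha)$-simplex $\mathbb S^q_\alpha$, $\mathrm H^I_k(\mathbb S^q_\alpha)=\mathbb Z$ if $k=0$ and $\varepsilon\ge\alpha$, and $\mathrm H^I_k(\mathbb S^q_\alpha)=0$ otherwise. Here $\mathbb Z$ is one and the same coefficient group for all simplices: there are isomorphisms $\mathrm H^I_0(\mathbb S^q_\alpha)\cong\mathbb Z$, one for each $(q,\alpha)$-simplex with $\alpha\le\varepsilon$, under which every filtration preserving map between two such simplices induces the identity of $\mathbb Z$. -/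

import Mathlib

open CategoryTheory

universe u

noncomputable section

namespace PersistentHomology

/-- A filtered set `(X, F)` whose finite underlying set `X` consists of points of `V`.
The filtration is a monotone function on the nonempty subsets (simplices) of `X` with values in
`(-∞, M]`. The function `F` is total for convenience; the field `eq_M` fixes its irrelevant values
on all other arguments, so that two filtered sets are equal exactly when they have the same
underlying set and the same filtration. -/
@[ext]
structure FilteredSet (M : EReal) (V : Type u) where
  carrier : Finset V
  F : Finset V → EReal
  bot_lt : ∀ σ, σ.Nonempty → σ ⊆ carrier → ⊥ < F σ
  le_M : ∀ σ, σ.Nonempty → σ ⊆ carrier → F σ ≤ M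
  mono : ∀ σ τ, σ.Nonempty → σ ⊆ τ → τ ⊆ carrier → F σ ≤ F τ
  eq_M : ∀ σ, ¬ (σ.Nonempty ∧ σ ⊆ carrier) → F σ = M

namespace FilteredSet

variable {M : EReal} {V W U : Type u}

theorem F_le_M (X : FilteredSet M V) (σ : Finset V) : X.F σ ≤ M := by
  by_cases h : σ.Nonempty ∧ σ ⊆ X.carrier
  · exact X.le_M σ h.1 h.2
  · exact (X.eq_M σ h).le

/-- The empty filtered set. -/
def empty (M : EReal) (V : Type u) : FilteredSet M V where
  carrier := ∅
  F _ := M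
  bot_lt σ hσ h := by
    rw [Finset.subset_empty.1 h] at hσ
    exact absurd hσ Finset.not_nonempty_empty
  le_M _ _ _ := le_rfl
  mono _ _ _ _ _ := le_rfl
  eq_M _ _ := rfl

/-- `A` is a filtered subset of `X`: `A ⊆ X` as sets, and `F_A ≥ F_X` on the simplices of `A`. -/
def IsSubset (A X : FilteredSet M V) : Prop :=
  A.carrier ⊆ X.carrier ∧
    ∀ σ : Finset V, σ.Nonempty → σ ⊆ A.carrier → X.F σ ≤ A.F σ

theorem empty_isSubset (X : FilteredSet M V) : (empty M V).IsSubset X :=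
  ⟨Finset.empty_subset _, fun σ _ _ => X.F_le_M σ⟩

theorem IsSubset.refl (X : FilteredSet M V) : X.IsSubset X :=
  ⟨Finset.Subset.refl _, fun _ _ _ => le_rfl⟩

open scoped Classical in
/-- The union of two filtered sets. -/
def union (X Y : FilteredSet M V) : FilteredSet M V where
  carrier := X.carrier ∪ Y.carrier
  F σ :=
    if σ.Nonempty ∧ σ ⊆ X.carrier ∧ σ ⊆ Y.carrier then min (X.F σ) (Y.F σ)
    else if σ.Nonempty ∧ σ ⊆ X.carrier then X.F σ
    else if σ.Nonempty ∧ σ ⊆ Y.carrier then Y.F σ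
    else M
  bot_lt σ hσ h := by
    have hx := X.bot_lt σ hσ
    have hy := Y.bot_lt σ hσ
    have hM : ⊥ < M := by
      obtain ⟨v, hv⟩ := hσ
      rcases Finset.mem_union.1 (h hv) with h' | h'
      · exact (X.bot_lt {v} ⟨v, by simp⟩ (by simpa using h')).trans_le (X.F_le_M _)
      · exact (Y.bot_lt {v} ⟨v, by simp⟩ (by simpa using h')).trans_le (Y.F_le_M _)
    split_ifs with h1 h2 h3
    · exact lt_min (hx h1.2.1) (hy h1.2.2)
    · exact hx h2.2
    · exact hy h3.2
    · exact hM
  le_M σ _ _ := by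
    split_ifs
    · exact (min_le_left _ _).trans (X.F_le_M σ)
    · exact X.F_le_M σ
    · exact Y.F_le_M σ
    · exact le_rfl
  mono σ τ hσ hστ _ := by
    have hx := X.mono σ τ hσ hστ
    have hy := Y.mono σ τ hσ hστ
    have hτ : τ.Nonempty := hσ.mono hστ
    have hx' : τ ⊆ X.carrier → σ ⊆ X.carrier := fun h => hστ.trans h
    have hy' : τ ⊆ Y.carrier → σ ⊆ Y.carrier := fun h => hστ.trans h
    have hxM := X.F_le_M σ
    have hyM := Y.F_le_M σ
    by_cases a : τ ⊆ X.carrier <;> by_cases b : τ ⊆ Y.carrier <;>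
      by_cases c : σ ⊆ X.carrier <;> by_cases d : σ ⊆ Y.carrier <;>
      simp_all
  eq_M σ h := by
    have h1 : ¬ (σ.Nonempty ∧ σ ⊆ X.carrier) := fun h' =>
      h ⟨h'.1, h'.2.trans Finset.subset_union_left⟩
    have h2 : ¬ (σ.Nonempty ∧ σ ⊆ Y.carrier) := fun h' =>
      h ⟨h'.1, h'.2.trans Finset.subset_union_right⟩
    rw [if_neg fun h' => h1 ⟨h'.1, h'.2.1⟩, if_neg h1, if_neg h2]

open scoped Classical in
/-- The intersection of two filtered sets. -/
def inter (X Y : FilteredSet M V) : FilteredSet M V where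
  carrier := X.carrier ∩ Y.carrier
  F σ := if σ.Nonempty ∧ σ ⊆ X.carrier ∩ Y.carrier then max (X.F σ) (Y.F σ) else M
  bot_lt σ hσ h := by
    rw [if_pos ⟨hσ, h⟩]
    exact lt_max_of_lt_left (X.bot_lt σ hσ (h.trans Finset.inter_subset_left))
  le_M σ hσ h := by
    rw [if_pos ⟨hσ, h⟩]
    exact max_le (X.F_le_M σ) (Y.F_le_M σ)
  mono σ τ hσ hστ h := by
    rw [if_pos ⟨hσ, hστ.trans h⟩, if_pos ⟨hσ.mono hστ, h⟩]
    exact max_le_max (X.mono σ τ hσ hστ (h.trans Finset.inter_subset_left))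
      (Y.mono σ τ hσ hστ (h.trans Finset.inter_subset_right))
  eq_M σ h := if_neg h

theorem inter_isSubset_left (X Y : FilteredSet M V) : (X.inter Y).IsSubset X := by
  classical
  refine ⟨fun v hv => (Finset.mem_inter.1 hv).1, fun σ hσ h => ?_⟩
  have h' : (X.inter Y).F σ = max (X.F σ) (Y.F σ) := if_pos ⟨hσ, h⟩
  rw [h']
  exact le_max_left _ _

theorem inter_isSubset_right (X Y : FilteredSet M V) : (X.inter Y).IsSubset Y := by
  classical
  refine ⟨fun v hv => (Finset.mem_inter.1 hv).2, fun σ hσ h => ?_⟩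
  have h' : (X.inter Y).F σ = max (X.F σ) (Y.F σ) := if_pos ⟨hσ, h⟩
  rw [h']
  exact le_max_right _ _

theorem isSubset_union_left (X Y : FilteredSet M V) : X.IsSubset (X.union Y) := by
  classical
  refine ⟨fun v hv => Finset.mem_union_left _ hv, fun σ hσ h => ?_⟩
  by_cases hy : σ ⊆ Y.carrier <;> simp [union, hσ, h, hy]

theorem isSubset_union_right (X Y : FilteredSet M V) : Y.IsSubset (X.union Y) := by
  classical
  refine ⟨fun v hv => Finset.mem_union_right _ hv, fun σ hσ h => ?_⟩
  by_cases hx : σ ⊆ X.carrier <;> simp [union, hσ, h, hx]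

/-- A simplex of `X`, given as a finite set of elements of the underlying set of `X`, as a finite
set of points of the ambient type. -/
def simplex (X : FilteredSet M V) (σ : Finset X.carrier) : Finset V :=
  σ.map (Function.Embedding.subtype _)

open scoped Classical in
/-- A map of the underlying sets is filtration preserving if `F_X(σ) ≥ F_Y(f(σ))` for every
simplex `σ` of `X`. -/
def IsFiltrationPreserving (X : FilteredSet M V) (Y : FilteredSet M W)
    (f : X.carrier → Y.carrier) : Prop :=
  ∀ σ : Finset X.carrier, σ.Nonempty → Y.F (Y.simplex (σ.image f)) ≤ X.F (X.simplex σ)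

theorem IsFiltrationPreserving.id (X : FilteredSet M V) : IsFiltrationPreserving X X id := by
  classical
  intro σ _
  rw [Finset.image_id]

theorem IsFiltrationPreserving.comp {X : FilteredSet M V} {Y : FilteredSet M W}
    {Z : FilteredSet M U} {f : X.carrier → Y.carrier} {g : Y.carrier → Z.carrier}
    (hg : IsFiltrationPreserving Y Z g) (hf : IsFiltrationPreserving X Y f) :
    IsFiltrationPreserving X Z (g ∘ f) := by
  classical
  intro σ hσ
  rw [← Finset.image_image]
  exact (hg _ (hσ.image f)).trans (hf σ hσ)

theorem IsSubset.isFiltrationPreserving {A X : FilteredSet M V} (h : A.IsSubset X) :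
    IsFiltrationPreserving A X (fun a => ⟨a.1, h.1 a.2⟩) := by
  classical
  intro σ hσ
  have e : X.simplex (σ.image fun a => ⟨a.1, h.1 a.2⟩) = A.simplex σ := by
    ext v
    simp only [simplex, Finset.mem_map, Finset.mem_image, Function.Embedding.subtype_apply]
    constructor
    · rintro ⟨x, ⟨a, ha, rfl⟩, rfl⟩
      exact ⟨a, ha, rfl⟩
    · rintro ⟨a, ha, rfl⟩
      exact ⟨⟨a, h.1 a.2⟩, ⟨a, ha, rfl⟩, rfl⟩
  rw [e]
  refine h.2 _ (hσ.map) ?_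
  intro v hv
  simp only [simplex, Finset.mem_map, Function.Embedding.subtype_apply] at hv
  obtain ⟨a, -, rfl⟩ := hv
  exact a.2

/-- `S` is a `(q, α)`-simplex: it has `q + 1` points and its filtration is constantly `α`. -/
def IsSimplex (S : FilteredSet M V) (q : ℕ) (α : EReal) : Prop :=
  S.carrier.card = q + 1 ∧ ∀ σ : Finset V, σ.Nonempty → σ ⊆ S.carrier → S.F σ = α

end FilteredSet

/-- The intervals `[ε, ε']` with `0 ≤ ε ≤ ε' ≤ M`, the degenerate interval `[M, M]` excluded. -/
structure Interval (M : EReal) where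
  lo : ℝ
  hi : ℝ
  zero_le_lo : 0 ≤ lo
  lo_le_hi : lo ≤ hi
  hi_le : (hi : EReal) ≤ M
  lo_lt : (lo : EReal) < M

/-- The objects `((X, A); I)` of the category `RF`: a relative filtered set together with an
interval. The finite sets `A ⊆ X` consist of points of an arbitrary type `V`. -/
structure RF (M : EReal) where
  V : Type u
  X : FilteredSet M V
  A : FilteredSet M V
  sub : A.IsSubset X
  I : Interval M

namespace RF

variable {M : EReal}

/-- The morphisms of `RF`: there are none between objects with different intervals, and otherwise
they are the filtration preserving maps of relative filtered sets. -/
@[ext]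
structure Hom (P Q : RF.{u} M) where
  interval_eq : P.I = Q.I
  toFun : P.X.carrier → Q.X.carrier
  mapsTo : ∀ x, x.1 ∈ P.A.carrier → (toFun x).1 ∈ Q.A.carrier
  preserving : FilteredSet.IsFiltrationPreserving P.X Q.X toFun
  preserving_restrict : FilteredSet.IsFiltrationPreserving P.A Q.A
    (fun a => ⟨(toFun ⟨a, P.sub.1 a.2⟩).1, mapsTo ⟨a, P.sub.1 a.2⟩ a.2⟩)

instance : Category (RF.{u} M) where
  Hom := Hom
  id P :=
    { interval_eq := rfl
      toFun := id
      mapsTo := fun _ h => h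
      preserving := FilteredSet.IsFiltrationPreserving.id _
      preserving_restrict := FilteredSet.IsFiltrationPreserving.id _ }
  comp f g :=
    { interval_eq := f.interval_eq.trans g.interval_eq
      toFun := g.toFun ∘ f.toFun
      mapsTo := fun x h => g.mapsTo _ (f.mapsTo x h)
      preserving := g.preserving.comp f.preserving
      preserving_restrict := g.preserving_restrict.comp f.preserving_restrict }

/-- The pair `(X, A)` with the interval `I`. -/
abbrev pair {V : Type u} (X A : FilteredSet M V) (h : A.IsSubset X) (I : Interval M) : RF.{u} M :=
  ⟨V, X, A, h, I⟩

/-- The pair `(X, ∅)` with the interval `I`. -/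
abbrev single {V : Type u} (X : FilteredSet M V) (I : Interval M) : RF.{u} M :=
  pair X (FilteredSet.empty M V) X.empty_isSubset I

/-- The inclusion of pairs `(X, A) ↪ (X', A')`. -/
def incl {V : Type u} {X A X' A' : FilteredSet M V} (h : A.IsSubset X) (h' : A'.IsSubset X')
    (hX : X.IsSubset X') (hA : A.IsSubset A') (I : Interval M) :
    pair X A h I ⟶ pair X' A' h' I where
  interval_eq := rfl
  toFun x := ⟨x.1, hX.1 x.2⟩
  mapsTo _ hx := hA.1 hx
  preserving := hX.isFiltrationPreserving
  preserving_restrict := hA.isFiltrationPreserving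

/-- The functor `((X, A); I) ↦ ((A, ∅); I)`, `f ↦ f|_A`. -/
def restrict : RF.{u} M ⥤ RF.{u} M where
  obj P := single P.A P.I
  map {P Q} f :=
    { interval_eq := f.interval_eq
      toFun := fun a => ⟨(f.toFun ⟨a.1, P.sub.1 a.2⟩).1, f.mapsTo ⟨a.1, P.sub.1 a.2⟩ a.2⟩
      mapsTo := fun x hx => absurd hx (Finset.notMem_empty x.1)
      preserving := f.preserving_restrict
      preserving_restrict := fun _ hσ => by
        obtain ⟨a, -⟩ := hσ
        exact absurd a.2 (Finset.notMem_empty a.1) }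
  map_id _ := rfl
  map_comp _ _ := rfl

end RF

/-- A pair `(H, ∂)`: a functor `H` from `RF` to (graded) abelian groups, given by its components
`H n`, and a natural transformation `∂ : H(X, A) ⟶ H(A, ∅)` of degree `-1`. -/
structure Theory (M : EReal) where
  H : ℤ → RF.{u} M ⥤ AddCommGrpCat.{u}
  bd : ∀ n : ℤ, H (n + 1) ⟶ RF.restrict ⋙ H n

namespace Theory

variable {M : EReal}

/-- The inclusion `(X, X ∩ Y) ↪ (X ∪ Y, Y)` induces an isomorphism. -/
def ExcisionAxiom (T : Theory.{u} M) : Prop :=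
  ∀ (V : Type u) (X Y : FilteredSet M V) (I : Interval M) (n : ℤ),
    IsIso ((T.H n).map (RF.incl (X.inter_isSubset_left Y) (X.isSubset_union_right Y)
      (X.isSubset_union_left Y) (X.inter_isSubset_right Y) I))

/-- For every pair `(X, A)` the triangle `H(A) ⟶ H(X) ⟶ H(X, A) ⟶ H(A)` is exact. -/
def ExactnessAxiom (T : Theory.{u} M) : Prop :=
  ∀ (V : Type u) (X A : FilteredSet M V) (h : A.IsSubset X) (I : Interval M) (n : ℤ),
    let i : RF.single A I ⟶ RF.single X I :=
      RF.incl A.empty_isSubset X.empty_isSubset h (FilteredSet.IsSubset.refl _) I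
    let j : RF.single X I ⟶ RF.pair X A h I :=
      RF.incl X.empty_isSubset h (FilteredSet.IsSubset.refl X) A.empty_isSubset I
    let d : (T.H (n + 1)).obj (RF.pair X A h I) ⟶ (T.H n).obj (RF.single A I) :=
      (T.bd n).app (RF.pair X A h I)
    Function.Exact ((T.H n).map i) ((T.H n).map j) ∧
      Function.Exact ((T.H (n + 1)).map j) d ∧
      Function.Exact d ((T.H n).map i)

/-- For a `(q, α)`-simplex `S`, the group `H_k(S)` is `ℤ` if `k = 0` and `α ≤ ε`, and it is zero
otherwise. Here `ℤ` is one and the same coefficient group for all simplices: the identifications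
`H_0(S) ≃ ℤ` are compatible with the maps that filtration preserving maps of simplices induce. -/
def SimplexAxiom (T : Theory.{u} M) : Prop :=
  ∀ I : Interval M,
    (∀ (V : Type u) (S : FilteredSet M V) (q : ℕ) (α : EReal) (k : ℤ), S.IsSimplex q α →
      ¬ (k = 0 ∧ α ≤ I.lo) → Subsingleton ((T.H k).obj (RF.single S I))) ∧
    ∃ φ : ∀ (V : Type u) (S : FilteredSet M V) (q : ℕ) (α : EReal), S.IsSimplex q α →
        α ≤ I.lo → ((T.H 0).obj (RF.single S I) ≃+ ℤ),
      ∀ (V V' : Type u) (S : FilteredSet M V) (S' : FilteredSet M V') (q q' : ℕ) (α α' : EReal)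
        (hS : S.IsSimplex q α) (hS' : S'.IsSimplex q' α') (hα : α ≤ I.lo) (hα' : α' ≤ I.lo)
        (f : RF.single S I ⟶ RF.single S' I) (x : (T.H 0).obj (RF.single S I)),
        φ V' S' q' α' hS' hα' ((T.H 0).map f x) = φ V S q α hS hα x

/-- The three simplified axioms. -/
def SatisfiesAxioms (T : Theory.{u} M) : Prop :=
  T.ExcisionAxiom ∧ T.ExactnessAxiom ∧ T.SimplexAxiom

/-- Isomorphism of pairs `(H, ∂)`: natural isomorphisms in every degree that commute with the
boundary transformations. -/
def IsIsomorphic (T T' : Theory.{u} M) : Prop :=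
  ∃ e : ∀ n : ℤ, T.H n ≅ T'.H n, ∀ (n : ℤ) (P : RF.{u} M),
    (T.bd n).app P ≫ (e n).hom.app (RF.restrict.obj P) =
      (e (n + 1)).hom.app P ≫ (T'.bd n).app P

end Theory

end PersistentHomology

end

noncomputable section

namespace PersistentHomology

open scoped Classical

/-! ### Ordered chains on a type of vertices -/

/-! Existence is simplicial homology. For `I = [ε, ε']` the simplices of filtration at most `ε` form
a simplicial complex, and the homology of its ordered chains (tuples of vertices, repetitions
allowed) satisfies the axioms; `ε'` plays no role. Ordered chains let maps that identify vertices
act without signs or exceptions. Since `ε < M`, a simplex of value `M` is simply absent, so chains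
of a union form the sum, and chains of an intersection the intersection, of the two chain groups
(`chains_union`, `chains_inter`). This gives excision; a cone contracts a simplex.

For uniqueness, every theory `T` is compared with simplicial homology. `sk c X` keeps the simplices
with at most `c` points, that is, of dimension at most `c - 1`. A filtered set is built by attaching
simplices along their boundaries (`cell_induction`), whence `H_k (sk c X) = 0` for `c ≤ k`
(`subsingleton_sk`). So `H_n (sk (n + 1) X)` embeds in the cellular chains `H_n (sk (n + 1) X, sk n
X)`.

As with acyclic models, classes of the standard simplices are chosen degree by degree so that the
cellular boundary of each is the sum of its faces (`exists_fundamental`). In positive degrees the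
vanishing homology of a simplex suffices; in degree zero the two ends of an edge must carry the same
class, which is the coherence in the simplex axiom. Naturality then gives a chain map `psi` from
ordered to cellular chains.

A relative cycle `z` determines a unique class of `(sk (n + 2) X, sk (n + 1) A)` whose cellular
chain and boundary are `psi z` and `psi (∂z)` (`exists_represents`, `Represents.unique`). Its image
in `H_{n+1}(X, A)` defines the comparison `theta`, natural and compatible with `∂`. It is an
isomorphism on simplices, where only the class of a vertex matters, and then everywhere by excision,
the five lemma and `cell_induction`. It is never needed that `psi` is an isomorphism. -/

/-- Integral combinations of lists of vertices. -/
abbrev Chains (V : Type u) : Type u := List V →₀ ℤ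

namespace Chains

variable {V W U : Type u}

/-- The cone on a chain with apex `v`. -/
def cone (v : V) : Chains V →ₗ[ℤ] Chains V := Finsupp.lmapDomain ℤ ℤ (List.cons v)

@[simp] theorem cone_single (v : V) (t : List V) (a : ℤ) :
    cone v (Finsupp.single t a) = Finsupp.single (v :: t) a := by
  simp [cone, Finsupp.mapDomain_single]

/-- The augmented boundary of a list. -/
def augBdryList : List V → Chains V
  | [] => 0
  | v :: t => Finsupp.single t 1 - cone v (augBdryList t)

/-- The augmented boundary; the empty list is the simplex of degree `-1`. -/
def augBdry : Chains V →ₗ[ℤ] Chains V := Finsupp.linearCombination ℤ augBdryList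

theorem augBdry_single (t : List V) : augBdry (Finsupp.single t 1) = augBdryList t := by
  simp [augBdry]

@[simp] theorem augBdry_nil (a : ℤ) : augBdry (Finsupp.single ([] : List V) a) = 0 := by
  simp [augBdry, augBdryList]

/-- Keeping the empty list as a simplex of degree `-1` makes this valid in every degree, vertices
included. Both the vanishing of the squared boundary and the contraction of simplices rest on it. -/
theorem augBdry_cone (v : V) (c : Chains V) :
    augBdry (cone v c) = c - cone v (augBdry c) := by
  have : augBdry ∘ₗ cone v = LinearMap.id - cone v ∘ₗ augBdry := by
    ext1 t
    ext1
    simp [augBdry, augBdryList]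
  exact LinearMap.congr_fun this c

theorem augBdry_augBdryList (t : List V) : augBdry (augBdryList t) = 0 := by
  induction t with
  | nil => simp [augBdryList]
  | cons v t ih => simp [augBdryList, augBdry_cone, augBdry_single, ih]

theorem augBdry_augBdry (c : Chains V) : augBdry (augBdry c) = 0 := by
  have : augBdry ∘ₗ augBdry = (0 : Chains V →ₗ[ℤ] Chains V) := by
    ext1 t
    ext1
    simp [augBdry_single, augBdry_augBdryList]
  exact LinearMap.congr_fun this c

/-- Removes the empty list from a chain. -/
def dropNil : Chains V →ₗ[ℤ] Chains V :=
  LinearMap.id - Finsupp.lsingle [] ∘ₗ Finsupp.lapply []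

theorem dropNil_apply (c : Chains V) : dropNil c = c - Finsupp.single [] (c []) := rfl

theorem dropNil_single {t : List V} (h : t ≠ []) (a : ℤ) :
    dropNil (Finsupp.single t a) = Finsupp.single t a := by
  simp [dropNil_apply, h]

theorem dropNil_single_nil (a : ℤ) : dropNil (Finsupp.single ([] : List V) a) = 0 := by
  simp [dropNil_apply]

/-- The boundary of an ordered chain. -/
def bdry : Chains V →ₗ[ℤ] Chains V := dropNil ∘ₗ augBdry

theorem bdry_apply (c : Chains V) : bdry c = augBdry c - Finsupp.single [] (augBdry c []) := rfl

/-- The discarded multiple of the empty list has augmented boundary zero, so the identity is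
inherited from `augBdry`. -/
theorem bdry_bdry (c : Chains V) : bdry (bdry c) = 0 := by
  rw [bdry_apply (bdry c), bdry_apply c, map_sub, augBdry_nil, augBdry_augBdry]
  simp

/-- Two linear maps that agree on the basis of a space of supported chains agree on it. -/
theorem eqOn_supported {N : Type*} [AddCommGroup N] {s : Set (List V)}
    {f g : Chains V →ₗ[ℤ] N}
    (h : ∀ t ∈ s, f (Finsupp.single t 1) = g (Finsupp.single t 1)) {c : Chains V}
    (hc : c ∈ Finsupp.supported ℤ ℤ s) : f c = g c := by
  rw [Finsupp.supported_eq_span_single] at hc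
  refine LinearMap.eqOn_span (f := f) (g := g) ?_ hc
  rintro _ ⟨t, ht, rfl⟩
  exact h t ht

/-- A linear map sends supported chains to a submodule if it does so on the basis. -/
theorem map_mem_of_supported {N : Type*} [AddCommGroup N] {s : Set (List V)}
    {f : Chains V →ₗ[ℤ] N} {K : Submodule ℤ N}
    (h : ∀ t ∈ s, f (Finsupp.single t 1) ∈ K) {c : Chains V}
    (hc : c ∈ Finsupp.supported ℤ ℤ s) : f c ∈ K := by
  rw [Finsupp.supported_eq_span_single] at hc
  have : Submodule.span ℤ ((fun i : List V => Finsupp.single i (1 : ℤ)) '' s) ≤ K.comap f := by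
    rw [Submodule.span_le]
    rintro _ ⟨t, ht, rfl⟩
    exact h t ht
  exact this hc

theorem cone_mem_supported {s s' : Set (List V)} {v : V} (h : ∀ t ∈ s, v :: t ∈ s')
    {c : Chains V} (hc : c ∈ Finsupp.supported ℤ ℤ s) :
    cone v c ∈ Finsupp.supported ℤ ℤ s' :=
  map_mem_of_supported (fun t ht => by
    rw [cone_single]; exact Finsupp.single_mem_supported ℤ 1 (h t ht)) hc

theorem augBdryList_mem (t : List V) :
    augBdryList t ∈ Finsupp.supported ℤ ℤ {r : List V | r.length + 1 = t.length ∧ r ⊆ t} := by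
  induction t with
  | nil => exact zero_mem _
  | cons v t ih =>
    refine sub_mem (Finsupp.single_mem_supported ℤ 1 ?_) (cone_mem_supported ?_ ih)
    · simp
    · rintro r ⟨h1, h2⟩
      refine ⟨by simp [h1], ?_⟩
      exact List.cons_subset_cons v h2

theorem dropNil_mem {s : Set (List V)} {c : Chains V} (hc : c ∈ Finsupp.supported ℤ ℤ s) :
    dropNil c ∈ Finsupp.supported ℤ ℤ {r | r ∈ s ∧ r ≠ []} := by
  refine map_mem_of_supported (fun t ht => ?_) hc
  by_cases h : t = []
  · subst h
    rw [dropNil_single_nil]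
    exact zero_mem _
  · rw [dropNil_single h]
    exact Finsupp.single_mem_supported ℤ 1 ⟨ht, h⟩

theorem bdry_single_mem (t : List V) :
    bdry (Finsupp.single t 1) ∈
      Finsupp.supported ℤ ℤ {r : List V | (r.length + 1 = t.length ∧ r ⊆ t) ∧ r ≠ []} := by
  change dropNil (augBdry _) ∈ _
  rw [augBdry_single]
  exact dropNil_mem (augBdryList_mem t)

/-- Dropping the empty list does not change a chain without constant term. -/
theorem dropNil_eq_self {c : Chains V} (h : c [] = 0) : dropNil c = c := by
  simp [dropNil_apply, h]

theorem apply_nil_eq_zero {s : Set (List V)} {c : Chains V} (hc : c ∈ Finsupp.supported ℤ ℤ s)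
    (h : [] ∉ s) : c [] = 0 :=
  (Finsupp.mem_supported' ℤ c).1 hc [] h

/-- The map of chains induced by a partially defined map of vertices. -/
def push (f : V → Option W) : Chains V →ₗ[ℤ] Chains W :=
  Finsupp.lmapDomain ℤ ℤ (List.filterMap f)

@[simp] theorem push_single (f : V → Option W) (t : List V) (a : ℤ) :
    push f (Finsupp.single t a) = Finsupp.single (t.filterMap f) a := by
  simp [push, Finsupp.mapDomain_single]

theorem push_cone {f : V → Option W} {v : V} {w : W} (h : f v = some w) (c : Chains V) :
    push f (cone v c) = cone w (push f c) := by
  have : push f ∘ₗ cone v = cone w ∘ₗ push f := by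
    ext1 t
    ext1
    simp [List.filterMap_cons_some h]
  exact LinearMap.congr_fun this c

/-- Without definedness on all entries `filterMap` would shorten the list, and its faces would no
longer correspond. -/
theorem push_augBdryList {f : V → Option W} {t : List V} (h : ∀ v ∈ t, (f v).isSome) :
    push f (augBdryList t) = augBdryList (t.filterMap f) := by
  induction t with
  | nil => simp [augBdryList]
  | cons v t ih =>
    obtain ⟨w, hw⟩ := Option.isSome_iff_exists.1 (h v (by simp))
    rw [List.filterMap_cons_some hw, augBdryList, augBdryList, map_sub, push_cone hw,
      ih fun x hx => h x (by simp [hx]), push_single]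

theorem push_bdry {f : V → Option W} {c : Chains V}
    (hc : c ∈ Finsupp.supported ℤ ℤ {t : List V | ∀ v ∈ t, (f v).isSome}) :
    push f (bdry c) = bdry (push f c) := by
  refine eqOn_supported (f := push f ∘ₗ bdry) (g := bdry ∘ₗ push f) (fun t ht => ?_) hc
  have key : ∀ d ∈ Finsupp.supported ℤ ℤ {t : List V | ∀ v ∈ t, (f v).isSome},
      push f (dropNil d) = dropNil (push f d) := by
    intro d hd
    refine eqOn_supported (f := push f ∘ₗ dropNil) (g := dropNil ∘ₗ push f) (fun r hr => ?_) hd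
    rcases r with _ | ⟨v, r⟩
    · simp [dropNil_single_nil]
    · obtain ⟨w, hw⟩ := Option.isSome_iff_exists.1 (hr v (by simp))
      simp [dropNil_single, List.filterMap_cons_some hw]
  simp only [LinearMap.comp_apply, bdry, push_single, augBdry_single]
  rw [key, push_augBdryList ht]
  refine Finsupp.supported_mono ?_ (augBdryList_mem t)
  exact fun r hr v hv => ht v (hr.2 hv)

theorem push_push (f : V → Option W) (g : W → Option U) (c : Chains V) :
    push g (push f c) = push (fun v => (f v).bind g) c := by
  have : push g ∘ₗ push f = push (fun v => (f v).bind g) := by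
    ext1 t
    ext1
    simp [List.filterMap_filterMap]
  exact LinearMap.congr_fun this c

end Chains

/-! ### Chains of a filtered set -/

open Chains

namespace FilteredSet

variable {M : EReal} {V W U : Type u}

/-- The lists of vertices that span a simplex of filtration at most `ε`. -/
def IsSmall (X : FilteredSet M V) (I : Interval M) (t : List V) : Prop :=
  X.F t.toFinset ≤ I.lo

theorem nonempty_and_subset_of_lt {X : FilteredSet M V} {σ : Finset V} (h : X.F σ < M) :
    σ.Nonempty ∧ σ ⊆ X.carrier := by
  by_contra h'
  exact h.ne (X.eq_M σ h')

theorem IsSmall.ne_nil {X : FilteredSet M V} {I : Interval M} {t : List V}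
    (h : X.IsSmall I t) : t ≠ [] := by
  rintro rfl
  simpa using (nonempty_and_subset_of_lt (h.trans_lt I.lo_lt)).1

theorem IsSmall.mem {X : FilteredSet M V} {I : Interval M} {t : List V}
    (h : X.IsSmall I t) {v : V} (hv : v ∈ t) : v ∈ X.carrier :=
  (nonempty_and_subset_of_lt (h.trans_lt I.lo_lt)).2 (List.mem_toFinset.2 hv)

theorem IsSmall.of_subset {X : FilteredSet M V} {I : Interval M} {t r : List V}
    (h : X.IsSmall I t) (hr : r ⊆ t) (hr' : r ≠ []) : X.IsSmall I r := by
  refine (X.mono _ _ ?_ ?_ (nonempty_and_subset_of_lt (h.trans_lt I.lo_lt)).2).trans h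
  · simpa using hr'
  · exact fun v hv => List.mem_toFinset.2 (hr (List.mem_toFinset.1 hv))

theorem IsSmall.of_isSubset {A X : FilteredSet M V} (h : A.IsSubset X) {I : Interval M}
    {t : List V} (ht : A.IsSmall I t) : X.IsSmall I t :=
  (h.2 _ (by simpa using ht.ne_nil) fun _ hv => ht.mem (List.mem_toFinset.1 hv)).trans ht

/-- The ordered chains of degree `n` of the complex of simplices of filtration at most `ε`. -/
def chains (X : FilteredSet M V) (I : Interval M) (n : ℤ) : Submodule ℤ (Chains V) :=
  Finsupp.supported ℤ ℤ {t | (t.length : ℤ) = n + 1 ∧ X.IsSmall I t}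

theorem single_mem_chains {X : FilteredSet M V} {I : Interval M} {n : ℤ} {t : List V}
    (h : (t.length : ℤ) = n + 1) (ht : X.IsSmall I t) :
    Finsupp.single t 1 ∈ X.chains I n :=
  Finsupp.single_mem_supported ℤ 1 ⟨h, ht⟩

theorem chains_mono {A X : FilteredSet M V} (h : A.IsSubset X) (I : Interval M) (n : ℤ) :
    A.chains I n ≤ X.chains I n :=
  Finsupp.supported_mono fun _ ht => ⟨ht.1, ht.2.of_isSubset h⟩

theorem bdry_mem_chains {X : FilteredSet M V} {I : Interval M} {n : ℤ} {c : Chains V}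
    (hc : c ∈ X.chains I n) : bdry c ∈ X.chains I (n - 1) := by
  refine map_mem_of_supported (fun t ht => ?_) hc
  refine Finsupp.supported_mono ?_ (bdry_single_mem t)
  rintro r ⟨⟨h1, h2⟩, h3⟩
  refine ⟨?_, ht.2.of_subset h2 h3⟩
  have := ht.1
  omega

theorem bdry_mem_chains_succ {X : FilteredSet M V} {I : Interval M} {n : ℤ} {c : Chains V}
    (hc : c ∈ X.chains I (n + 1)) : bdry c ∈ X.chains I n := by
  simpa using bdry_mem_chains hc

theorem chains_eq_bot_of_neg (X : FilteredSet M V) (I : Interval M) {n : ℤ} (hn : n < 0) :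
    X.chains I n = ⊥ := by
  rw [chains, ← Finsupp.supported_empty]
  congr 1
  ext t
  simp only [Set.mem_ofPred_eq, Set.mem_empty_iff_false, iff_false, not_and]
  intro h ht
  have := List.length_pos_of_ne_nil ht.ne_nil
  omega

theorem chains_eq_bot_of_lt {X : FilteredSet M V} {I : Interval M}
    (h : ∀ σ : Finset V, I.lo < X.F σ) (n : ℤ) : X.chains I n = ⊥ := by
  rw [chains, ← Finsupp.supported_empty]
  congr 1
  ext t
  simp only [Set.mem_ofPred_eq, Set.mem_empty_iff_false, iff_false, not_and]
  exact fun _ ht => absurd ht (not_le.2 (h _))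

theorem chains_empty (I : Interval M) (n : ℤ) : (empty M V).chains I n = ⊥ :=
  chains_eq_bot_of_lt (fun _ => I.lo_lt) n

/-- A minimum is at most `ε` when one of the values is, and a simplex of the union inside neither
`X` nor `Y` has the value `M > ε`. So every small list is already small in `X` or in `Y`. -/
theorem chains_union (X Y : FilteredSet M V) (I : Interval M) (n : ℤ) :
    (X.union Y).chains I n = X.chains I n ⊔ Y.chains I n := by
  refine le_antisymm ?_ (sup_le (chains_mono (X.isSubset_union_left Y) I n)
    (chains_mono (X.isSubset_union_right Y) I n))
  rw [chains, chains, chains, ← Finsupp.supported_union]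
  refine Finsupp.supported_mono ?_
  rintro t ⟨h1, h2⟩
  have : X.IsSmall I t ∨ Y.IsSmall I t := by
    have hM := I.lo_lt
    unfold IsSmall union at h2
    dsimp only at h2
    split_ifs at h2
    · exact min_le_iff.1 h2
    · exact Or.inl h2
    · exact Or.inr h2
    · exact absurd h2 (not_le.2 hM)
  exact this.imp (fun h => ⟨h1, h⟩) (fun h => ⟨h1, h⟩)

theorem chains_inter (X Y : FilteredSet M V) (I : Interval M) (n : ℤ) :
    (X.inter Y).chains I n = X.chains I n ⊓ Y.chains I n := by
  refine le_antisymm (le_inf (chains_mono (X.inter_isSubset_left Y) I n)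
    (chains_mono (X.inter_isSubset_right Y) I n)) ?_
  rw [chains, chains, chains, ← Finsupp.supported_inter]
  refine Finsupp.supported_mono ?_
  rintro t ⟨⟨h1, h2⟩, -, h3⟩
  refine ⟨h1, ?_⟩
  have h : t.toFinset.Nonempty ∧ t.toFinset ⊆ X.carrier ∩ Y.carrier := by
    refine ⟨by simpa using h2.ne_nil, fun v hv => Finset.mem_inter.2 ⟨?_, ?_⟩⟩
    · exact h2.mem (List.mem_toFinset.1 hv)
    · exact h3.mem (List.mem_toFinset.1 hv)
  unfold IsSmall inter
  dsimp only
  rw [if_pos h]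
  exact max_le h2 h3

/-- A map of underlying sets as a partial map of the ambient types. -/
def partialMap {X : FilteredSet M V} {Y : FilteredSet M W} (f : X.carrier → Y.carrier) :
    V → Option W :=
  fun v => if h : v ∈ X.carrier then some (f ⟨v, h⟩).1 else none

/-! ### Chain maps induced by maps of filtered sets -/

section partialMap

variable {X : FilteredSet M V} {Y : FilteredSet M W}

theorem partialMap_coe (f : X.carrier → Y.carrier) (x : X.carrier) :
    partialMap f x.1 = some (f x).1 := by
  simp [partialMap]

theorem filterMap_partialMap (f : X.carrier → Y.carrier) (s : List X.carrier) :
    (s.map Subtype.val).filterMap (partialMap f) = s.map fun x => (f x).1 := by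
  rw [List.filterMap_map]
  have : partialMap f ∘ Subtype.val = fun x : X.carrier => some (f x).1 :=
    funext (partialMap_coe f)
  rw [this, ← List.filterMap_eq_map]
  rfl

/-- The chain map induced by a map of the underlying sets. -/
def chainMap (f : X.carrier → Y.carrier) : Chains V →ₗ[ℤ] Chains W := push (partialMap f)

theorem chainMap_single (f : X.carrier → Y.carrier) (s : List X.carrier) :
    chainMap f (Finsupp.single (s.map Subtype.val) 1) =
      Finsupp.single (s.map fun x => (f x).1) 1 := by
  rw [chainMap, push_single, filterMap_partialMap]

theorem IsSmall.exists_list {X : FilteredSet M V} {I : Interval M} {t : List V}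
    (h : X.IsSmall I t) : ∃ s : List X.carrier, t = s.map Subtype.val := by
  lift t to List X.carrier using fun v hv => h.mem hv
  exact ⟨t, rfl⟩

theorem IsSmall.map {f : X.carrier → Y.carrier} (hf : IsFiltrationPreserving X Y f)
    {I : Interval M} {s : List X.carrier} (h : X.IsSmall I (s.map Subtype.val)) :
    Y.IsSmall I (s.map fun x => (f x).1) := by
  have hs : s ≠ [] := by
    rintro rfl
    exact h.ne_nil rfl
  have e1 : X.simplex s.toFinset = (s.map Subtype.val).toFinset := by
    ext v; simp [simplex]
  have e2 : Y.simplex (s.toFinset.image f) = (s.map fun x => (f x).1).toFinset := by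
    ext v; simp only [simplex, Finset.mem_map, Finset.mem_image, List.mem_toFinset,
      Function.Embedding.subtype_apply, List.mem_map]
    constructor
    · rintro ⟨_, ⟨a, ha, rfl⟩, rfl⟩
      exact ⟨a, ha, rfl⟩
    · rintro ⟨a, ha, rfl⟩
      exact ⟨_, ⟨a, ha, rfl⟩, rfl⟩
  have := hf s.toFinset (by simpa using hs)
  rw [e1, e2] at this
  exact this.trans h

theorem chainMap_mem {f : X.carrier → Y.carrier} (hf : IsFiltrationPreserving X Y f)
    {I : Interval M} {n : ℤ} {c : Chains V} (hc : c ∈ X.chains I n) :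
    chainMap f c ∈ Y.chains I n := by
  refine map_mem_of_supported (fun t ht => ?_) hc
  obtain ⟨s, rfl⟩ := ht.2.exists_list
  rw [chainMap_single]
  exact single_mem_chains (by simpa using ht.1) (ht.2.map hf)

theorem chainMap_bdry (f : X.carrier → Y.carrier) {I : Interval M} {n : ℤ} {c : Chains V}
    (hc : c ∈ X.chains I n) : chainMap f (bdry c) = bdry (chainMap f c) := by
  refine push_bdry (Finsupp.supported_mono ?_ hc)
  intro t ht v hv
  simp [partialMap, ht.2.mem hv]

/-- Maps that agree on a filtered subset induce the same map on its chains. -/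
theorem chainMap_congr {X' : FilteredSet M V} {Y' : FilteredSet M W} (f : X.carrier → Y.carrier)
    (g : X'.carrier → Y'.carrier) {A : FilteredSet M V} {I : Interval M} {n : ℤ} {c : Chains V}
    (hc : c ∈ A.chains I n)
    (h : ∀ v ∈ A.carrier, partialMap f v = partialMap g v) : chainMap f c = chainMap g c := by
  refine eqOn_supported (fun t ht => ?_) hc
  rw [chainMap, chainMap, push_single, push_single,
    List.filterMap_congr fun v hv => h v (ht.2.mem hv)]

theorem chainMap_eq_self {X' : FilteredSet M V} {f : X.carrier → X'.carrier}
    (hf : ∀ x, (f x).1 = x.1) {I : Interval M} {n : ℤ} {c : Chains V}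
    (hc : c ∈ X.chains I n) : chainMap f c = c := by
  refine eqOn_supported (f := chainMap f) (g := LinearMap.id) (fun t ht => ?_) hc
  obtain ⟨s, rfl⟩ := ht.2.exists_list
  rw [chainMap_single]
  simp [hf]

theorem chainMap_comp {Z : FilteredSet M U} (f : X.carrier → Y.carrier)
    (g : Y.carrier → Z.carrier) (c : Chains V) :
    chainMap (g ∘ f) c = chainMap g (chainMap f c) := by
  rw [chainMap, chainMap, chainMap, push_push]
  congr 2
  funext v
  by_cases h : v ∈ X.carrier <;> simp [partialMap, h]

end partialMap

end FilteredSet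

open Chains FilteredSet

/-! ### The simplicial homology of relative filtered sets -/

namespace Simplicial

variable {M : EReal}

/-- The relative cycles of degree `n`. -/
def cycles (P : RF.{u} M) (n : ℤ) : Submodule ℤ (Chains P.V) :=
  P.X.chains P.I n ⊓ (P.A.chains P.I (n - 1)).comap bdry

/-- The relative boundaries of degree `n`. -/
def boundaries (P : RF.{u} M) (n : ℤ) : Submodule ℤ (Chains P.V) :=
  (P.X.chains P.I (n + 1)).map bdry ⊔ P.A.chains P.I n

theorem mem_cycles {P : RF.{u} M} {n : ℤ} {c : Chains P.V} :
    c ∈ cycles P n ↔ c ∈ P.X.chains P.I n ∧ bdry c ∈ P.A.chains P.I (n - 1) := Iff.rfl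

theorem mem_cycles_succ {P : RF.{u} M} {n : ℤ} {c : Chains P.V} :
    c ∈ cycles P (n + 1) ↔ c ∈ P.X.chains P.I (n + 1) ∧ bdry c ∈ P.A.chains P.I n := by
  rw [mem_cycles, add_sub_cancel_right]

theorem mem_cycles_single {V : Type u} {X : FilteredSet M V} {I : Interval M} {n : ℤ}
    {c : Chains V} : c ∈ cycles (RF.single X I) n ↔ c ∈ X.chains I n ∧ bdry c = 0 := by
  rw [mem_cycles, chains_empty, Submodule.mem_bot]

theorem mem_boundaries {P : RF.{u} M} {n : ℤ} {c : Chains P.V} :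
    c ∈ boundaries P n ↔
      ∃ w ∈ P.X.chains P.I (n + 1), ∃ a ∈ P.A.chains P.I n, bdry w + a = c := by
  simp only [boundaries, Submodule.mem_sup, Submodule.mem_map]
  constructor
  · rintro ⟨_, ⟨w, hw, rfl⟩, a, ha, rfl⟩
    exact ⟨w, hw, a, ha, rfl⟩
  · rintro ⟨w, hw, a, ha, rfl⟩
    exact ⟨_, ⟨w, hw, rfl⟩, a, ha, rfl⟩

theorem mem_boundaries_single {V : Type u} {X : FilteredSet M V} {I : Interval M} {n : ℤ}
    {c : Chains V} :
    c ∈ boundaries (RF.single X I) n ↔ ∃ w ∈ X.chains I (n + 1), bdry w = c := by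
  rw [mem_boundaries]
  simp only [chains_empty, Submodule.mem_bot]
  constructor
  · rintro ⟨w, hw, _, rfl, rfl⟩
    exact ⟨w, hw, by simp⟩
  · rintro ⟨w, hw, rfl⟩
    exact ⟨w, hw, 0, rfl, by simp⟩

/-- The chain map induced by a morphism. -/
def homChainMap {P Q : RF.{u} M} (f : P ⟶ Q) : Chains P.V →ₗ[ℤ] Chains Q.V :=
  chainMap (RF.Hom.toFun f)

section homChainMap

variable {P Q R : RF.{u} M}

/-- The restriction of a morphism of pairs to the second components. -/
def restrictHom (f : P ⟶ Q) : RF.single P.A P.I ⟶ RF.single Q.A Q.I := RF.restrict.map f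

theorem chainMap_restrict (f : P ⟶ Q) {n : ℤ} {c : Chains P.V} (hc : c ∈ P.A.chains P.I n) :
    homChainMap (restrictHom f) c = homChainMap f c :=
  chainMap_congr _ _ hc fun v hv =>
    (partialMap_coe (RF.Hom.toFun (restrictHom f)) ⟨v, hv⟩).trans
      (partialMap_coe (RF.Hom.toFun f) ⟨v, P.sub.1 hv⟩).symm

theorem homChainMap_mem (f : P ⟶ Q) {n : ℤ} {c : Chains P.V} (hc : c ∈ P.X.chains P.I n) :
    homChainMap f c ∈ Q.X.chains Q.I n :=
  RF.Hom.interval_eq f ▸ chainMap_mem (RF.Hom.preserving f) hc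

theorem homChainMap_mem_right (f : P ⟶ Q) {n : ℤ} {c : Chains P.V}
    (hc : c ∈ P.A.chains P.I n) : homChainMap f c ∈ Q.A.chains Q.I n := by
  rw [← chainMap_restrict f hc]
  exact homChainMap_mem (restrictHom f) hc

theorem homChainMap_bdry (f : P ⟶ Q) {n : ℤ} {c : Chains P.V} (hc : c ∈ P.X.chains P.I n) :
    homChainMap f (bdry c) = bdry (homChainMap f c) :=
  chainMap_bdry _ hc

theorem homChainMap_comp (f : P ⟶ Q) (g : Q ⟶ R) (c : Chains P.V) :
    homChainMap (f ≫ g) c = homChainMap g (homChainMap f c) :=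
  chainMap_comp (RF.Hom.toFun f) (RF.Hom.toFun g) c

theorem homChainMap_id {n : ℤ} {c : Chains P.V} (hc : c ∈ P.X.chains P.I n) :
    homChainMap (𝟙 P) c = c :=
  chainMap_eq_self (fun _ => rfl) hc

theorem homChainMap_cycles (f : P ⟶ Q) {n : ℤ} {c : Chains P.V} (hc : c ∈ cycles P n) :
    homChainMap f c ∈ cycles Q n := by
  refine ⟨homChainMap_mem f hc.1, ?_⟩
  change bdry (homChainMap f c) ∈ Q.A.chains Q.I (n - 1)
  rw [← homChainMap_bdry f hc.1]
  exact homChainMap_mem_right f hc.2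

theorem homChainMap_boundaries (f : P ⟶ Q) {n : ℤ} {c : Chains P.V} (hc : c ∈ boundaries P n) :
    homChainMap f c ∈ boundaries Q n := by
  obtain ⟨w, hw, a, ha, rfl⟩ := mem_boundaries.1 hc
  rw [map_add, homChainMap_bdry f hw]
  exact mem_boundaries.2 ⟨_, homChainMap_mem f hw, _, homChainMap_mem_right f ha, rfl⟩

end homChainMap

/-- The relative homology group of degree `n`. -/
abbrev Homology (P : RF.{u} M) (n : ℤ) : Type u :=
  cycles P n ⧸ (boundaries P n).submoduleOf (cycles P n)

/-- The class of a relative cycle. -/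
def cls {P : RF.{u} M} {n : ℤ} (c : Chains P.V) (hc : c ∈ cycles P n) : Homology P n :=
  Submodule.Quotient.mk ⟨c, hc⟩

theorem exists_cls {P : RF.{u} M} {n : ℤ} (x : Homology P n) :
    ∃ c, ∃ hc : c ∈ cycles P n, cls c hc = x := by
  obtain ⟨⟨c, hc⟩, rfl⟩ := Submodule.Quotient.mk_surjective _ x
  exact ⟨c, hc, rfl⟩

theorem cls_eq_zero {P : RF.{u} M} {n : ℤ} {c : Chains P.V} {hc : c ∈ cycles P n} :
    cls c hc = 0 ↔ c ∈ boundaries P n := by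
  rw [cls, Submodule.Quotient.mk_eq_zero]
  rfl

theorem cls_eq_cls {P : RF.{u} M} {n : ℤ} {c d : Chains P.V} {hc : c ∈ cycles P n}
    {hd : d ∈ cycles P n} : cls c hc = cls d hd ↔ c - d ∈ boundaries P n := by
  rw [cls, cls, Submodule.Quotient.eq]
  rfl

/-- The homomorphism on homology induced by a linear map on cycles. -/
def lift {P : RF.{u} M} {n : ℤ} {N : Type*} [AddCommGroup N] (f : cycles P n →+ N)
    (h : ∀ c : cycles P n, c.1 ∈ boundaries P n → f c = 0) : Homology P n →+ N :=
  (((boundaries P n).submoduleOf (cycles P n)).liftQ f.toIntLinearMap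
    (fun c hc => h c hc)).toAddMonoidHom

/-- The homomorphism on homology induced by a chain-level linear map. -/
def induced {P Q : RF.{u} M} {n m : ℤ} (f : Chains P.V →ₗ[ℤ] Chains Q.V)
    (h : ∀ c ∈ cycles P n, f c ∈ cycles Q m) (h' : ∀ c ∈ cycles P n, c ∈ boundaries P n →
      f c ∈ boundaries Q m) : Homology P n →+ Homology Q m :=
  lift (((boundaries Q m).submoduleOf (cycles Q m)).mkQ.comp (f.restrict h)).toAddMonoidHom
    (fun c hc => by
      change Submodule.Quotient.mk _ = _
      rw [Submodule.Quotient.mk_eq_zero]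
      exact h' c.1 c.2 hc)

/-- The homomorphism on homology induced by a morphism. -/
def mapHom {P Q : RF.{u} M} (f : P ⟶ Q) (n : ℤ) : Homology P n →+ Homology Q n :=
  induced (homChainMap f) (fun _ hc => homChainMap_cycles f hc)
    (fun _ _ hc => homChainMap_boundaries f hc)

theorem mapHom_cls {P Q : RF.{u} M} (f : P ⟶ Q) {n : ℤ} (c : Chains P.V)
    (hc : c ∈ cycles P n) : mapHom f n (cls c hc) = cls _ (homChainMap_cycles f hc) := rfl

theorem bdry_mem_cycles {P : RF.{u} M} {n : ℤ} {c : Chains P.V} (hc : c ∈ cycles P (n + 1)) :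
    bdry c ∈ cycles (RF.single P.A P.I) n :=
  mem_cycles_single.2 ⟨(mem_cycles_succ.1 hc).2, bdry_bdry c⟩

/-- The boundary homomorphism of a pair. -/
def bdHom (P : RF.{u} M) (n : ℤ) : Homology P (n + 1) →+ Homology (RF.single P.A P.I) n :=
  induced (Q := RF.single P.A P.I) bdry (fun _ hc => bdry_mem_cycles hc) (fun c _ hc => by
    obtain ⟨w, -, a, ha, rfl⟩ := mem_boundaries.1 hc
    rw [map_add, bdry_bdry, zero_add]
    exact mem_boundaries_single.2 ⟨a, ha, rfl⟩)

theorem bdHom_cls {P : RF.{u} M} {n : ℤ} (c : Chains P.V) (hc : c ∈ cycles P (n + 1)) :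
    bdHom P n (cls c hc) = cls _ (bdry_mem_cycles hc) := rfl

/-- Simplicial homology as a theory. -/
def theory (M : EReal) : Theory.{u} M where
  H n :=
    { obj := fun P => AddCommGrpCat.of (Homology P n)
      map := fun f => AddCommGrpCat.ofHom (mapHom f n)
      map_id := fun P => by
        ext x
        obtain ⟨c, hc, rfl⟩ := exists_cls x
        change mapHom _ n (cls c hc) = cls c hc
        rw [mapHom_cls]
        congr 1
        exact homChainMap_id hc.1
      map_comp := fun f g => by
        ext x
        obtain ⟨c, hc, rfl⟩ := exists_cls x
        change mapHom _ n (cls c hc) = mapHom _ n (mapHom _ n (cls c hc))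
        simp only [mapHom_cls]
        congr 1
        exact homChainMap_comp f g c }
  bd n :=
    { app := fun P => AddCommGrpCat.ofHom (bdHom P n)
      naturality := fun P Q f => by
        ext x
        obtain ⟨c, hc, rfl⟩ := exists_cls x
        change bdHom Q n (mapHom f (n + 1) (cls c hc)) =
          mapHom (restrictHom f) n (bdHom P n (cls c hc))
        rw [mapHom_cls, bdHom_cls, bdHom_cls, mapHom_cls]
        congr 1
        rw [chainMap_restrict f (mem_cycles_succ.1 hc).2]
        exact (homChainMap_bdry f hc.1).symm }

theorem homChainMap_incl {V : Type u} {X A X' A' : FilteredSet M V} (h : A.IsSubset X)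
    (h' : A'.IsSubset X') (hX : X.IsSubset X') (hA : A.IsSubset A') (I : Interval M) {n : ℤ}
    {c : Chains V} (hc : c ∈ X.chains I n) : homChainMap (RF.incl h h' hX hA I) c = c :=
  chainMap_eq_self (fun _ => rfl) hc

/-- An inclusion fixes chains, so excision and exactness can be argued with representing chains
alone. -/
theorem mapHom_incl {V : Type u} {X A X' A' : FilteredSet M V} (h : A.IsSubset X)
    (h' : A'.IsSubset X') (hX : X.IsSubset X') (hA : A.IsSubset A') (I : Interval M) {n : ℤ}
    {c : Chains V} (hc : c ∈ cycles (RF.pair X A h I) n) :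
    ∃ hc', mapHom (RF.incl h h' hX hA I) n (cls c hc) = cls c hc' := by
  have e := homChainMap_incl h h' hX hA I hc.1
  have hc' := homChainMap_cycles (RF.incl h h' hX hA I) hc
  rw [e] at hc'
  refine ⟨hc', ?_⟩
  rw [mapHom_cls]
  congr 1

/-- In terms of chains this is the isomorphism `C(X) / (C(X) ∩ C(Y)) ≅ (C(X) + C(Y)) / C(Y)`. -/
theorem excisionAxiom : (theory.{u} M).ExcisionAxiom := by
  intro V X Y I n
  rw [ConcreteCategory.isIso_iff_bijective]
  change Function.Bijective (mapHom _ n)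
  constructor
  · rw [injective_iff_map_eq_zero]
    intro x hx
    obtain ⟨c, hc, rfl⟩ := exists_cls x
    obtain ⟨hc', e⟩ := mapHom_incl (X.inter_isSubset_left Y) (X.isSubset_union_right Y)
      (X.isSubset_union_left Y) (X.inter_isSubset_right Y) I hc
    rw [e, cls_eq_zero] at hx
    obtain ⟨w, hw, a, ha, hc''⟩ := mem_boundaries.1 hx
    dsimp only at hw ha hc''
    rw [chains_union, Submodule.mem_sup] at hw
    obtain ⟨w₁, hw₁, w₂, hw₂, rfl⟩ := hw
    rw [cls_eq_zero, mem_boundaries]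
    -- The chain `∂w₂ + a` lies in `Y`; it equals `c - ∂w₁`, so it lies in `X` as well.
    refine ⟨w₁, hw₁, bdry w₂ + a, ?_, ?_⟩
    · dsimp only
      rw [chains_inter]
      refine ⟨?_, add_mem (bdry_mem_chains_succ hw₂) ha⟩
      have : bdry w₂ + a = c - bdry w₁ := by rw [← hc'', map_add]; abel
      rw [this]
      exact sub_mem hc.1 (bdry_mem_chains_succ hw₁)
    · rw [← hc'', map_add]; abel
  · intro x
    obtain ⟨c, hc, rfl⟩ := exists_cls x
    have h1 := hc.1
    dsimp only at h1
    rw [chains_union, SetLike.mem_coe, Submodule.mem_sup] at h1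
    obtain ⟨a, ha, b, hb, rfl⟩ := h1
    -- The summand `b` in `Y` is zero in relative homology, and `∂a = ∂(a + b) - ∂b` lies in both
    -- `X` and `Y`.
    have haz : a ∈ cycles (RF.pair X (X.inter Y) (X.inter_isSubset_left Y) I) n := by
      refine ⟨ha, ?_⟩
      change bdry a ∈ (X.inter Y).chains I (n - 1)
      rw [chains_inter]
      refine ⟨bdry_mem_chains ha, ?_⟩
      have h2 := hc.2
      have : bdry a = bdry (a + b) - bdry b := by rw [map_add]; abel
      rw [this]
      exact sub_mem h2 (bdry_mem_chains hb)
    refine ⟨cls a haz, ?_⟩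
    obtain ⟨hc', e⟩ := mapHom_incl (X.inter_isSubset_left Y) (X.isSubset_union_right Y)
      (X.isSubset_union_left Y) (X.inter_isSubset_right Y) I haz
    rw [e, cls_eq_cls, mem_boundaries]
    exact ⟨0, zero_mem _, -b, neg_mem hb, by simp⟩

theorem exactnessAxiom : (theory.{u} M).ExactnessAxiom := by
  intro V X A h I n
  refine ⟨?_, ?_, ?_⟩
  · change Function.Exact (mapHom _ n) (mapHom _ n)
    intro x
    obtain ⟨c, hc, rfl⟩ := exists_cls x
    obtain ⟨hc', e⟩ := mapHom_incl X.empty_isSubset h (IsSubset.refl X) A.empty_isSubset I hc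
    rw [e, cls_eq_zero]
    constructor
    · intro hb
      obtain ⟨w, hw, a, ha, rfl⟩ := mem_boundaries.1 hb
      -- The absolute cycle is `∂w + a`, so `a` is itself a cycle and is homologous to it in `X`.
      have hz : bdry a = 0 := by
        have := (mem_cycles_single.1 hc).2
        rwa [map_add, bdry_bdry, zero_add] at this
      have haz : a ∈ cycles (RF.single A I) n := mem_cycles_single.2 ⟨ha, hz⟩
      refine ⟨cls a haz, ?_⟩
      obtain ⟨ha', e'⟩ := mapHom_incl A.empty_isSubset X.empty_isSubset h (IsSubset.refl _) I haz
      rw [e', cls_eq_cls, mem_boundaries_single]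
      exact ⟨-w, neg_mem hw, by simp⟩
    · rintro ⟨y, hy⟩
      obtain ⟨a, ha, rfl⟩ := exists_cls y
      obtain ⟨ha', e'⟩ := mapHom_incl A.empty_isSubset X.empty_isSubset h (IsSubset.refl _) I ha
      rw [e', cls_eq_cls, mem_boundaries_single] at hy
      obtain ⟨w, hw, hw'⟩ := hy
      refine mem_boundaries.2 ⟨-w, neg_mem hw, a, ha.1, ?_⟩
      rw [map_neg, hw']; abel
  · change Function.Exact (mapHom _ (n + 1)) (bdHom _ n)
    intro x
    obtain ⟨c, hc, rfl⟩ := exists_cls x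
    rw [bdHom_cls, cls_eq_zero]
    constructor
    · intro hb
      obtain ⟨a, ha, hac⟩ := mem_boundaries_single.1 hb
      -- As `∂c = ∂a` with `a` in `A`, the difference is an absolute cycle with the same relative
      -- class as `c`.
      have hd : c - a ∈ cycles (RF.single X I) (n + 1) :=
        mem_cycles_single.2 ⟨sub_mem hc.1 (chains_mono h I _ ha), by rw [map_sub, hac, sub_self]⟩
      refine ⟨cls (c - a) hd, ?_⟩
      obtain ⟨hd', e⟩ := mapHom_incl X.empty_isSubset h (IsSubset.refl X) A.empty_isSubset I hd
      rw [e, cls_eq_cls, mem_boundaries]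
      exact ⟨0, zero_mem _, -a, neg_mem ha, by simp⟩
    · rintro ⟨y, hy⟩
      obtain ⟨d, hd, rfl⟩ := exists_cls y
      obtain ⟨hd', e⟩ := mapHom_incl X.empty_isSubset h (IsSubset.refl X) A.empty_isSubset I hd
      rw [e, cls_eq_cls, mem_boundaries] at hy
      obtain ⟨w, hw, a, ha, hwa⟩ := hy
      refine mem_boundaries_single.2 ⟨-a, neg_mem ha, ?_⟩
      have : c = d - bdry w - a := by
        have : c = d - (d - c) := by abel
        rw [this, ← hwa]; abel
      rw [this, map_sub, map_sub, bdry_bdry, (mem_cycles_single.1 hd).2, map_neg]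
      abel
  · change Function.Exact (bdHom (RF.pair X A h I) n) (mapHom (RF.incl A.empty_isSubset
      X.empty_isSubset h (IsSubset.refl _) I) n)
    intro x
    obtain ⟨c, hc, rfl⟩ := exists_cls x
    obtain ⟨hc', e⟩ := mapHom_incl A.empty_isSubset X.empty_isSubset h (IsSubset.refl _) I hc
    rw [e, cls_eq_zero, mem_boundaries_single]
    constructor
    · rintro ⟨w, hw, rfl⟩
      exact ⟨cls w (mem_cycles_succ.2 ⟨hw, hc.1⟩), rfl⟩
    · rintro ⟨y, hy⟩
      obtain ⟨w, hw, rfl⟩ := exists_cls y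
      rw [bdHom_cls] at hy
      obtain ⟨a, ha, hwa⟩ := mem_boundaries_single.1 (cls_eq_cls.1 hy)
      refine ⟨w - a, sub_mem hw.1 (chains_mono h I _ ha), ?_⟩
      rw [map_sub, hwa]; abel

end Simplicial

/-! ### Augmentation and the homology of simplices -/

namespace Chains

variable {V W : Type u}

/-- The sum of the coefficients of a chain. -/
def aug : Chains V →ₗ[ℤ] ℤ := Finsupp.linearCombination ℤ fun _ => 1

@[simp] theorem aug_single (t : List V) (a : ℤ) : aug (Finsupp.single t a) = a := by
  simp [aug]

theorem aug_push (f : V → Option W) (c : Chains V) : aug (push f c) = aug c := by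
  have : aug ∘ₗ push f = aug := by
    ext1 t
    ext1
    simp
  exact LinearMap.congr_fun this c

end Chains

namespace Simplicial

variable {M : EReal} {V : Type u}

theorem isSmall_of_isSimplex {S : FilteredSet M V} {q : ℕ} {α : EReal} (hS : S.IsSimplex q α)
    {I : Interval M} (hα : α ≤ I.lo) {t : List V} (ht : t ≠ []) (h : ∀ v ∈ t, v ∈ S.carrier) :
    S.IsSmall I t :=
  (hS.2 _ (by simpa using ht) fun v hv => h v (List.mem_toFinset.1 hv)).le.trans hα

theorem exists_mem_of_isSimplex {S : FilteredSet M V} {q : ℕ} {α : EReal}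
    (hS : S.IsSimplex q α) : ∃ v, v ∈ S.carrier := by
  have : S.carrier.Nonempty := Finset.card_pos.1 (by rw [hS.1]; omega)
  exact this

theorem cone_mem_chains {S : FilteredSet M V} {q : ℕ} {α : EReal} (hS : S.IsSimplex q α)
    {I : Interval M} (hα : α ≤ I.lo) {v : V} (hv : v ∈ S.carrier) {n : ℤ} {c : Chains V}
    (hc : c ∈ S.chains I n) : cone v c ∈ S.chains I (n + 1) := by
  refine cone_mem_supported ?_ hc
  rintro t ⟨h1, h2⟩
  refine ⟨by simp [h1], isSmall_of_isSimplex hS hα (by simp) ?_⟩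
  intro w hw
  rcases List.mem_cons.1 hw with rfl | hw
  · exact hv
  · exact h2.mem hw

theorem apply_nil_of_mem_chains {X : FilteredSet M V} {I : Interval M} {n : ℤ} {c : Chains V}
    (hc : c ∈ X.chains I n) : c [] = 0 :=
  apply_nil_eq_zero hc fun h => h.2.ne_nil rfl

/-- Neither `c` nor a cone contains the empty list, so nothing is dropped. The augmented boundary
must stay on the right: for `c` of degree zero it is a multiple of the empty list, whose cone is a
multiple of the vertex `v`. -/
theorem bdry_cone {X : FilteredSet M V} {I : Interval M} {n : ℤ} {c : Chains V}
    (hc : c ∈ X.chains I n) (v : V) : bdry (cone v c) = c - cone v (augBdry c) := by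
  change dropNil (augBdry (cone v c)) = _
  rw [augBdry_cone]
  apply dropNil_eq_self
  have h1 : (cone v (augBdry c)) [] = 0 := by
    have : cone v (augBdry c) ∈ Finsupp.supported ℤ ℤ {t : List V | t ≠ []} :=
      cone_mem_supported (s := Set.univ) (by simp) (by simp [Finsupp.supported_univ])
    exact apply_nil_eq_zero this (by simp)
  rw [Finsupp.sub_apply, apply_nil_of_mem_chains hc, h1, sub_zero]

theorem augBdry_eq_bdry {X : FilteredSet M V} {I : Interval M} {n : ℤ} {c : Chains V}
    (hc : c ∈ X.chains I n) (hn : 0 < n) : augBdry c = bdry c := by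
  refine eqOn_supported (fun t ht => ?_) hc
  change _ = dropNil (augBdry _)
  rw [augBdry_single]
  refine (dropNil_eq_self (apply_nil_eq_zero (augBdryList_mem t) ?_)).symm
  rintro ⟨h, -⟩
  have h1 : (t.length : ℤ) = n + 1 := ht.1
  simp only [List.length_nil] at h
  omega

theorem augBdry_eq_aug {X : FilteredSet M V} {I : Interval M} {c : Chains V}
    (hc : c ∈ X.chains I 0) : augBdry c = Finsupp.single [] (aug c) := by
  refine eqOn_supported (f := augBdry) (g := Finsupp.lsingle [] ∘ₗ aug) (fun t ht => ?_) hc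
  have h1 : (t.length : ℤ) = 0 + 1 := ht.1
  obtain ⟨v, rfl⟩ : ∃ v, t = [v] := List.length_eq_one_iff.1 (by omega)
  simp [augBdry_single, augBdryList]

/-- In degree zero `augBdry` is the augmentation, so this is the vanishing of `augBdry ∘ augBdry` in
degree one. -/
theorem aug_bdry {X : FilteredSet M V} {I : Interval M} {c : Chains V}
    (hc : c ∈ X.chains I 1) : aug (bdry c) = 0 := by
  have h := augBdry_eq_aug (bdry_mem_chains_succ (n := 0) hc)
  rw [← augBdry_eq_bdry hc one_pos, augBdry_augBdry] at h
  rw [← augBdry_eq_bdry hc one_pos]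
  exact (Finsupp.single_eq_zero.1 h.symm)

theorem bdry_eq_zero_of_degree_zero {X : FilteredSet M V} {I : Interval M} {c : Chains V}
    (hc : c ∈ X.chains I 0) : bdry c = 0 := by
  rw [bdry_apply, augBdry_eq_aug hc]
  simp

theorem subsingleton_homology {S : FilteredSet M V} {q : ℕ} {α : EReal} (hS : S.IsSimplex q α)
    (I : Interval M) {k : ℤ} (h : ¬ (k = 0 ∧ α ≤ I.lo)) :
    Subsingleton (Homology (RF.single S I) k) := by
  suffices ∀ x : Homology (RF.single S I) k, x = 0 from
    ⟨fun x y => (this x).trans (this y).symm⟩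
  intro x
  obtain ⟨c, hc, rfl⟩ := exists_cls x
  rw [cls_eq_zero]
  obtain ⟨hc1, hc2⟩ := mem_cycles_single.1 hc
  by_cases hα : α ≤ I.lo
  · rcases lt_trichotomy k 0 with hk | hk | hk
    · rw [chains_eq_bot_of_neg S I hk, Submodule.mem_bot] at hc1
      rw [hc1]
      exact zero_mem _
    · exact absurd ⟨hk, hα⟩ h
    -- In positive degree the cone with apex `v` is a contraction: a cycle is the boundary of its
    -- cone.
    · obtain ⟨v, hv⟩ := exists_mem_of_isSimplex hS
      refine mem_boundaries_single.2 ⟨cone v c, cone_mem_chains hS hα hv hc1, ?_⟩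
      rw [bdry_cone hc1, augBdry_eq_bdry hc1 hk, hc2, map_zero, sub_zero]
  · have hlt : ∀ σ, (I.lo : EReal) < S.F σ := by
      intro σ
      by_cases hσ : σ.Nonempty ∧ σ ⊆ S.carrier
      · rw [hS.2 σ hσ.1 hσ.2]
        exact not_le.1 hα
      · rw [S.eq_M σ hσ]
        exact I.lo_lt
    rw [chains_eq_bot_of_lt hlt, Submodule.mem_bot] at hc1
    rw [hc1]
    exact zero_mem _

/-- The augmentation of the homology of degree zero. -/
def augHom (X : FilteredSet M V) (I : Interval M) : Homology (RF.single X I) 0 →+ ℤ :=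
  lift (aug.comp (cycles (RF.single X I) 0).subtype).toAddMonoidHom (by
    rintro ⟨c, hc⟩ hb
    obtain ⟨w, hw, rfl⟩ := mem_boundaries_single.1 hb
    exact aug_bdry hw)

theorem augHom_cls {X : FilteredSet M V} {I : Interval M} {c : Chains V}
    (hc : c ∈ cycles (RF.single X I) 0) : augHom X I (cls c hc) = aug c := rfl

/-- Pushing forward preserves sums of coefficients; this is the coherence that the simplex axiom
demands. -/
theorem augHom_mapHom {V' : Type u} {X : FilteredSet M V} {Y : FilteredSet M V'}
    {I : Interval M} (f : RF.single X I ⟶ RF.single Y I) (x : Homology (RF.single X I) 0) :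
    augHom Y I (mapHom f 0 x) = augHom X I x := by
  obtain ⟨c, hc, rfl⟩ := exists_cls x
  exact aug_push _ c

theorem vertex_mem_cycles {S : FilteredSet M V} {q : ℕ} {α : EReal} (hS : S.IsSimplex q α)
    {I : Interval M} (hα : α ≤ I.lo) {v : V} (hv : v ∈ S.carrier) :
    Finsupp.single [v] 1 ∈ cycles (RF.single S I) 0 := by
  have : Finsupp.single [v] 1 ∈ S.chains I 0 :=
    single_mem_chains (by simp) (isSmall_of_isSimplex hS hα (by simp) (by simpa using hv))
  exact mem_cycles_single.2 ⟨this, bdry_eq_zero_of_degree_zero this⟩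

/-- The cone on a chain `c` of degree zero has boundary `c - aug c • [v]`, so the augmentation
detects the class, and the vertex `v` has augmentation one. -/
theorem augHom_bijective {S : FilteredSet M V} {q : ℕ} {α : EReal} (hS : S.IsSimplex q α)
    {I : Interval M} (hα : α ≤ I.lo) : Function.Bijective (augHom S I) := by
  obtain ⟨v, hv⟩ := exists_mem_of_isSimplex hS
  constructor
  · rw [injective_iff_map_eq_zero]
    intro x hx
    obtain ⟨c, hc, rfl⟩ := exists_cls x
    rw [augHom_cls] at hx
    have hc1 := (mem_cycles_single.1 hc).1
    refine cls_eq_zero.2 (mem_boundaries_single.2 ⟨cone v c, cone_mem_chains hS hα hv hc1, ?_⟩)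
    rw [bdry_cone hc1, augBdry_eq_aug hc1, hx]
    simp
  · intro a
    refine ⟨a • cls _ (vertex_mem_cycles hS hα hv), ?_⟩
    rw [map_zsmul, augHom_cls, aug_single, smul_eq_mul, mul_one]

theorem simplexAxiom : (theory.{u} M).SimplexAxiom := by
  intro I
  refine ⟨fun V S q α k hS h => subsingleton_homology hS I h,
    fun V S q α hS hα => AddEquiv.ofBijective (augHom S I) (augHom_bijective hS hα), ?_⟩
  intro V V' S S' q q' α α' hS hS' hα hα' f x
  exact augHom_mapHom f x

theorem satisfiesAxioms : (theory.{u} M).SatisfiesAxioms :=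
  ⟨excisionAxiom, exactnessAxiom, simplexAxiom⟩

end Simplicial

/-! ### Induction over the simplices of a filtered set -/

namespace FilteredSet

variable {M : EReal} {V : Type u}

/-- The simplices of filtration less than `M`. -/
def proper (X : FilteredSet M V) : Finset (Finset V) :=
  X.carrier.powerset.filter fun σ => X.F σ < M

theorem mem_proper {X : FilteredSet M V} {σ : Finset V} : σ ∈ X.proper ↔ X.F σ < M := by
  rw [proper, Finset.mem_filter, Finset.mem_powerset, and_iff_right_iff_imp]
  exact fun h => (nonempty_and_subset_of_lt h).2

/-- The filtered set in which the value of a maximal proper simplex is replaced by `M`. -/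
def drop (X : FilteredSet M V) (σ : Finset V) (h : ∀ τ, σ ⊂ τ → X.F τ = M) :
    FilteredSet M V where
  carrier := X.carrier
  F τ := if τ = σ then M else X.F τ
  bot_lt τ h1 h2 := by
    split_ifs
    · exact (X.bot_lt τ h1 h2).trans_le (X.F_le_M τ)
    · exact X.bot_lt τ h1 h2
  le_M τ _ _ := by
    split_ifs
    · exact le_rfl
    · exact X.F_le_M τ
  mono τ ρ h1 h2 h3 := by
    split_ifs with a b b
    · exact le_rfl
    · subst a
      rw [h ρ (Finset.ssubset_iff_subset_ne.2 ⟨h2, Ne.symm b⟩)]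
    · exact X.F_le_M τ
    · exact X.mono τ ρ h1 h2 h3
  eq_M τ h := by
    split_ifs
    · rfl
    · exact X.eq_M τ h

/-- The face `σ` of `X` with the constant filtration `F σ`. -/
def face (X : FilteredSet M V) (σ : Finset V) (h : X.F σ < M) : FilteredSet M V where
  carrier := σ
  F τ := if τ.Nonempty ∧ τ ⊆ σ then X.F σ else M
  bot_lt τ h1 h2 := by
    rw [if_pos ⟨h1, h2⟩]
    exact X.bot_lt σ (nonempty_and_subset_of_lt h).1 (nonempty_and_subset_of_lt h).2
  le_M τ h1 h2 := by
    rw [if_pos ⟨h1, h2⟩]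
    exact h.le
  mono τ ρ h1 h2 h3 := by
    rw [if_pos ⟨h1, h2.trans h3⟩, if_pos ⟨h1.mono h2, h3⟩]
  eq_M τ h := if_neg h

theorem face_isSimplex (X : FilteredSet M V) (σ : Finset V) (h : X.F σ < M) :
    (X.face σ h).IsSimplex (σ.card - 1) (X.F σ) := by
  refine ⟨?_, fun τ h1 h2 => if_pos ⟨h1, h2⟩⟩
  have := Finset.card_pos.2 (nonempty_and_subset_of_lt h).1
  change σ.card = _
  omega

/-- At proper faces `τ` of `σ` the minimum is `F τ` because `F τ ≤ F σ`; at `σ` itself the value `M`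
gives way to `F σ`. -/
theorem face_union_drop (X : FilteredSet M V) (σ : Finset V) (h : ∀ τ, σ ⊂ τ → X.F τ = M)
    (hσ : X.F σ < M) : (X.face σ hσ).union (X.drop σ h) = X := by
  have hsub := (nonempty_and_subset_of_lt hσ).2
  have hne := (nonempty_and_subset_of_lt hσ).1
  have hc : σ ∪ X.carrier = X.carrier := Finset.union_eq_right.2 hsub
  refine FilteredSet.ext hc ?_
  funext τ
  simp only [union, face, drop]
  by_cases h0 : τ.Nonempty
  · by_cases h1 : τ ⊆ σ
    · have h2 : τ ⊆ X.carrier := h1.trans hsub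
      have h3 := X.mono τ σ h0 h1 hsub
      by_cases h4 : τ = σ
      · subst h4
        simp [h0, h2, hσ.le]
      · simp [h0, h1, h2, h3, h4]
    · have h4 : τ ≠ σ := by rintro rfl; exact h1 (Finset.Subset.refl _)
      by_cases h2 : τ ⊆ X.carrier
      · simp [h0, h1, h2, h4]
      · simp [h0, h1, h2, X.eq_M τ fun h => h2 h.2]
  · simp [h0, X.eq_M τ fun h => h0 h.1]

theorem proper_drop_ssubset {X : FilteredSet M V} {σ : Finset V}
    (h : ∀ τ, σ ⊂ τ → X.F τ = M) (hσ : X.F σ < M) : (X.drop σ h).proper ⊂ X.proper := by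
  have h2 : σ ∉ (X.drop σ h).proper := by simp [mem_proper, drop]
  refine (Finset.ssubset_iff_of_subset fun τ hτ => ?_).2 ⟨σ, mem_proper.2 hσ, h2⟩
  by_cases e : τ = σ
  · subst e; exact absurd hτ h2
  · rw [mem_proper] at hτ ⊢
    simpa [drop, e] using hτ

theorem F_inter_of_mem {X Y : FilteredSet M V} {σ : Finset V} (h : (X.inter Y).F σ < M) :
    (X.inter Y).F σ = max (X.F σ) (Y.F σ) :=
  if_pos (nonempty_and_subset_of_lt h)

theorem proper_inter_subset (X Y : FilteredSet M V) : (X.inter Y).proper ⊆ Y.proper := by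
  intro τ hτ
  rw [mem_proper] at hτ ⊢
  rw [F_inter_of_mem hτ] at hτ
  exact (le_max_right _ _).trans_lt hτ

/-- Every filtered set is built from the empty one by attaching simplices along their
boundaries. -/
theorem cell_induction {P : FilteredSet M V → Prop} (hempty : P (empty M V))
    (hsimplex : ∀ (S : FilteredSet M V) q α, S.IsSimplex q α → P S)
    (hunion : ∀ (S Y : FilteredSet M V) q α, S.IsSimplex q α → (S.inter Y).F S.carrier = M → P Y →
      P (S.inter Y) → P (S.union Y)) (X : FilteredSet M V) : P X := by
  induction hn : X.proper.card using Nat.strong_induction_on generalizing X with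
  | _ n ih =>
  subst hn
  by_cases hX : X.proper.Nonempty
  -- Detach an inclusion-maximal simplex of value below `M`. Both the rest and its intersection with
  -- the face have fewer proper simplices than `X`.
  · obtain ⟨σ, hσ, hmax⟩ := X.proper.exists_maximal hX
    have h : ∀ τ, σ ⊂ τ → X.F τ = M := by
      intro τ hτ
      by_contra hne
      exact hτ.2 (hmax (mem_proper.2 (lt_of_le_of_ne (X.F_le_M τ) hne)) hτ.1)
    have hσ' := mem_proper.1 hσ
    have hlt := proper_drop_ssubset h hσ'
    have key := hunion (X.face σ hσ') (X.drop σ h) _ _ (X.face_isSimplex σ hσ') ?_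
      (ih _ (Finset.card_lt_card hlt) _ rfl)
      (ih _ (Finset.card_lt_card ((proper_inter_subset _ _).trans_ssubset hlt)) _ rfl)
    · rwa [face_union_drop] at key
    -- The face `σ` is not in the intersection, since its value in the second set was raised to `M`.
    · by_contra hne
      have h1 := F_inter_of_mem (lt_of_le_of_ne (F_le_M _ _) hne)
      refine hne (le_antisymm (F_le_M _ _) ?_)
      rw [h1]
      refine le_trans ?_ (le_max_right _ _)
      simp [drop, face]
  -- Without proper simplices the filtration is constantly `M`, so a nonempty `X` is itself a
  -- simplex.
  · have hM : ∀ σ, X.F σ = M := fun σ => by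
      by_contra hne
      exact hX ⟨σ, mem_proper.2 (lt_of_le_of_ne (X.F_le_M σ) hne)⟩
    by_cases hc : X.carrier = ∅
    · have : X = empty M V := FilteredSet.ext hc (funext hM)
      rwa [this]
    · refine hsimplex X (X.carrier.card - 1) M ⟨?_, fun σ _ _ => hM σ⟩
      have := Finset.card_pos.2 (Finset.nonempty_iff_ne_empty.2 hc)
      omega

/-! ### Skeleta -/

/-- The filtered set in which the values of all simplices with more than `c` points are
replaced by `M`. -/
def sk (c : ℤ) (X : FilteredSet M V) : FilteredSet M V where
  carrier := X.carrier
  F σ := if (σ.card : ℤ) ≤ c then X.F σ else M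
  bot_lt σ h1 h2 := by
    split_ifs
    · exact X.bot_lt σ h1 h2
    · exact (X.bot_lt σ h1 h2).trans_le (X.F_le_M σ)
  le_M σ _ _ := by
    split_ifs
    · exact X.F_le_M σ
    · exact le_rfl
  mono σ τ h1 h2 h3 := by
    have := Finset.card_le_card h2
    split_ifs with a b b
    · exact X.mono σ τ h1 h2 h3
    · exact X.F_le_M σ
    · omega
    · exact le_rfl
  eq_M σ h := by
    split_ifs
    · exact X.eq_M σ h
    · rfl

theorem sk_isSubset (c : ℤ) (X : FilteredSet M V) : (sk c X).IsSubset X := by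
  refine ⟨Finset.Subset.refl _, fun σ _ _ => ?_⟩
  dsimp only [sk]
  split_ifs
  · exact le_rfl
  · exact X.F_le_M σ

theorem sk_mono {A X : FilteredSet M V} (h : A.IsSubset X) {c d : ℤ} (hcd : c ≤ d) :
    (sk c A).IsSubset (sk d X) := by
  refine ⟨h.1, fun σ h1 h2 => ?_⟩
  dsimp only [sk]
  split_ifs with a b b
  · exact h.2 σ h1 h2
  · exact X.F_le_M σ
  · omega
  · exact le_rfl

/-- An image has at most as many points as its source, so simplices beyond the bound never arise
from simplices within it. -/
theorem IsFiltrationPreserving.sk {W : Type u} {X : FilteredSet M V} {Y : FilteredSet M W}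
    {f : X.carrier → Y.carrier} (hf : IsFiltrationPreserving X Y f) (c : ℤ) :
    IsFiltrationPreserving (sk c X) (sk c Y) f := by
  intro σ hσ
  dsimp only [FilteredSet.sk]
  split_ifs with a b b
  · exact hf σ hσ
  · exact Y.F_le_M _
  · refine absurd ?_ a
    have h1 : ((simplex X σ).card : ℤ) ≤ c := b
    have h2 : (simplex Y (σ.image f)).card ≤ (simplex X σ).card :=
      (Finset.card_map _).trans_le
        ((Finset.card_image_le (s := σ) (f := f)).trans (Finset.card_map _).ge)
    have h3 : ((simplex Y (σ.image f)).card : ℤ) ≤ c := by omega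
    exact h3
  · exact le_rfl

end FilteredSet

/-! ### Consequences of the axioms -/

namespace Theory

variable {M : EReal} {V W : Type u} (T : Theory.{u} M)

/-- The homomorphism induced by a morphism. -/
def hom (n : ℤ) {P Q : RF.{u} M} (f : P ⟶ Q) : (T.H n).obj P →+ (T.H n).obj Q :=
  ((T.H n).map f).hom

/-- The boundary homomorphism of a pair. -/
def bdHom (n : ℤ) (P : RF.{u} M) : (T.H (n + 1)).obj P →+ (T.H n).obj (RF.single P.A P.I) :=
  ((T.bd n).app P).hom

variable {T}

theorem hom_hom {n : ℤ} {P Q R : RF.{u} M} (f : P ⟶ Q) (g : Q ⟶ R) (x : (T.H n).obj P) :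
    T.hom n g (T.hom n f x) = T.hom n (f ≫ g) x := by
  rw [hom, hom, hom, (T.H n).map_comp]
  rfl

theorem hom_id {n : ℤ} {P : RF.{u} M} (x : (T.H n).obj P) : T.hom n (𝟙 P) x = x := by
  rw [hom, (T.H n).map_id]
  rfl

theorem bdHom_hom {n : ℤ} {P Q : RF.{u} M} (f : P ⟶ Q) (x : (T.H (n + 1)).obj P) :
    T.bdHom n Q (T.hom (n + 1) f x) = T.hom n (Simplicial.restrictHom f) (T.bdHom n P x) :=
  ConcreteCategory.congr_hom ((T.bd n).naturality f) x

/-- Morphisms are determined by the maps on points, so diagrams of inclusions commute as soon as the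
points agree. -/
theorem hom_congr {n : ℤ} {P Q : RF.{u} M} {f g : P ⟶ Q}
    (h : ∀ x, RF.Hom.toFun f x = RF.Hom.toFun g x) (x : (T.H n).obj P) :
    T.hom n f x = T.hom n g x := by
  have : f = g := RF.Hom.ext (funext h)
  rw [this]

/-- The inclusion of absolute filtered sets. -/
def inclSingle {A X : FilteredSet M V} (h : A.IsSubset X) (I : Interval M) :
    RF.single A I ⟶ RF.single X I :=
  RF.incl A.empty_isSubset X.empty_isSubset h (IsSubset.refl _) I

/-- The inclusion of the absolute filtered set in a pair. -/
def inclPair {A X : FilteredSet M V} (h : A.IsSubset X) (I : Interval M) :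
    RF.single X I ⟶ RF.pair X A h I :=
  RF.incl X.empty_isSubset h (IsSubset.refl X) A.empty_isSubset I

section Exactness

variable (hT : T.SatisfiesAxioms) {A X : FilteredSet M V} (h : A.IsSubset X) (I : Interval M)
  (n : ℤ)
include hT

theorem exact_hom_hom : Function.Exact (T.hom n (inclSingle h I)) (T.hom n (inclPair h I)) :=
  (hT.2.1 V X A h I n).1

theorem exact_hom_bdHom :
    Function.Exact (T.hom (n + 1) (inclPair h I)) (T.bdHom n (RF.pair X A h I)) :=
  (hT.2.1 V X A h I n).2.1

theorem exact_bdHom_hom :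
    Function.Exact (T.bdHom n (RF.pair X A h I)) (T.hom n (inclSingle h I)) :=
  (hT.2.1 V X A h I n).2.2

end Exactness

theorem subsingleton_of_eq_zero {G : Type*} [AddCommGroup G] (h : ∀ x : G, x = 0) :
    Subsingleton G :=
  ⟨fun x y => (h x).trans (h y).symm⟩

variable (hT : T.SatisfiesAxioms) (I : Interval M)
include hT

theorem subsingleton_pair {A X : FilteredSet M V} (h : A.IsSubset X) (n : ℤ)
    (hX : Subsingleton ((T.H (n + 1)).obj (RF.single X I)))
    (hA : Subsingleton ((T.H n).obj (RF.single A I))) :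
    Subsingleton ((T.H (n + 1)).obj (RF.pair X A h I)) := by
  refine subsingleton_of_eq_zero fun x => ?_
  obtain ⟨y, rfl⟩ := (exact_hom_bdHom hT h I n x).1 (Subsingleton.elim _ _)
  rw [Subsingleton.elim y 0, map_zero]

theorem subsingleton_of_pair {A X : FilteredSet M V} (h : A.IsSubset X) (n : ℤ)
    (hX : Subsingleton ((T.H n).obj (RF.pair X A h I)))
    (hA : Subsingleton ((T.H n).obj (RF.single A I))) :
    Subsingleton ((T.H n).obj (RF.single X I)) := by
  refine subsingleton_of_eq_zero fun x => ?_
  obtain ⟨y, rfl⟩ := (exact_hom_hom hT h I n x).1 (Subsingleton.elim _ _)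
  rw [Subsingleton.elim y 0, map_zero]

theorem excision_bijective (X Y : FilteredSet M V) (n : ℤ) :
    Function.Bijective (T.hom n (RF.incl (X.inter_isSubset_left Y) (X.isSubset_union_right Y)
      (X.isSubset_union_left Y) (X.inter_isSubset_right Y) I)) :=
  (ConcreteCategory.isIso_iff_bijective _).1 (hT.1 V X Y I n)

/-- The homology of the empty filtered set vanishes. -/
theorem subsingleton_empty (n : ℤ) : Subsingleton ((T.H n).obj (RF.single (empty M V) I)) := by
  refine subsingleton_of_eq_zero fun x => ?_
  have h := exact_hom_hom hT (IsSubset.refl (empty M V)) I n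
  -- For the pair `(∅, ∅)` both maps of the exact sequence are the identity, so every class is in
  -- the image of one and hence killed by the other.
  have h1 : T.hom n (inclSingle (IsSubset.refl (empty M V)) I) x = x := hom_id x
  have h2 : T.hom n (inclPair (IsSubset.refl (empty M V)) I) x = x := hom_id x
  rw [← h2]
  exact (h x).2 ⟨x, h1⟩

/-- Homology vanishes from the number of points of the largest simplices on, and in all degrees
if there are no simplices. -/
theorem subsingleton_of_card_le (X : FilteredSet M V) {c k : ℤ}
    (hX : ∀ σ, X.F σ ≤ I.lo → (σ.card : ℤ) ≤ c) (hk : c ≤ k ∨ c ≤ 0) :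
    Subsingleton ((T.H k).obj (RF.single X I)) := by
  have simplexCase : ∀ (S : FilteredSet M V) q α, S.IsSimplex q α → ∀ c k : ℤ,
      (∀ σ, S.F σ ≤ I.lo → (σ.card : ℤ) ≤ c) → (c ≤ k ∨ c ≤ 0) →
      Subsingleton ((T.H k).obj (RF.single S I)) := by
    intro S q α hS c k hc hk
    refine (hT.2.2 I).1 V S q α k hS ?_
    rintro ⟨rfl, hα⟩
    -- If `k = 0` and `α ≤ ε`, the whole of `S` is a small simplex with at least one point, so `c ≥
    -- 1`, against both alternatives.
    have h1 := hS.1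
    have h2 := hc S.carrier ((hS.2 _ (Finset.card_pos.1 (by omega))
      (Finset.Subset.refl _)).le.trans hα)
    omega
  induction X using cell_induction generalizing c k with
  | hempty => exact subsingleton_empty hT I k
  | hsimplex S q α hS => exact simplexCase S q α hS c k hX hk
  | hunion S Y q α hS hM hY hSY =>
    have h1 : ∀ σ, Y.F σ ≤ I.lo → (σ.card : ℤ) ≤ c := fun σ hσ => by
      obtain ⟨a, b⟩ := nonempty_and_subset_of_lt (hσ.trans_lt I.lo_lt)
      exact hX σ (((S.isSubset_union_right Y).2 σ a b).trans hσ)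
    have h2 : ∀ σ, S.F σ ≤ I.lo → (σ.card : ℤ) ≤ c := fun σ hσ => by
      obtain ⟨a, b⟩ := nonempty_and_subset_of_lt (hσ.trans_lt I.lo_lt)
      exact hX σ (((S.isSubset_union_left Y).2 σ a b).trans hσ)
    obtain ⟨k, rfl⟩ : ∃ m, k = m + 1 := ⟨k - 1, by omega⟩
    refine subsingleton_of_pair hT I (S.isSubset_union_right Y) (k + 1) ?_ (hY h1 hk)
    have hinter : Subsingleton ((T.H k).obj (RF.single (S.inter Y) I)) := by
      -- Small simplices of the intersection are proper faces of `S`, so the bound on their points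
      -- drops by one together with the degree.
      refine hSY (c := if 0 < c then c - 1 else c) (fun σ hσ => ?_) (by split_ifs <;> omega)
      have hlt := hσ.trans_lt I.lo_lt
      have hS' : S.F σ ≤ I.lo := by
        rw [F_inter_of_mem hlt] at hσ
        exact (le_max_left _ _).trans hσ
      obtain ⟨a, b⟩ := nonempty_and_subset_of_lt (hS'.trans_lt I.lo_lt)
      have hne : σ ≠ S.carrier := by
        rintro rfl
        rw [hM] at hlt
        exact lt_irrefl _ hlt
      have h3 := Finset.card_lt_card (Finset.ssubset_iff_subset_ne.2 ⟨b, hne⟩)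
      have h4 := h2 S.carrier (by
        rw [hS.2 _ (a.mono b) (Finset.Subset.refl _), ← hS.2 σ a b]
        exact hS')
      split_ifs <;> omega
    have hpair := subsingleton_pair hT I (S.inter_isSubset_left Y) k
      (simplexCase S q α hS c (k + 1) h2 hk) hinter
    exact (Equiv.ofBijective _ (excision_bijective hT I S Y (k + 1))).symm.subsingleton

theorem subsingleton_sk (X : FilteredSet M V) {c k : ℤ} (hk : c ≤ k ∨ c ≤ 0) :
    Subsingleton ((T.H k).obj (RF.single (sk c X) I)) := by
  refine subsingleton_of_card_le hT I _ (fun σ hσ => ?_) hk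
  by_contra hc
  have : (sk c X).F σ = M := if_neg hc
  rw [this] at hσ
  exact absurd hσ (not_le.2 I.lo_lt)

end Theory

/-! ### Standard simplices -/

section Standard

variable {M : EReal} {V W : Type u}

/-- The standard simplex with `n + 1` points and constant filtration the left end of `I`. -/
def std (I : Interval M) (n : ℤ) : FilteredSet M (ULift.{u} ℕ) where
  carrier := (Finset.range (n + 1).toNat).map ⟨ULift.up, ULift.up_injective⟩
  F σ := if σ.Nonempty ∧ σ ⊆ (Finset.range (n + 1).toNat).map ⟨ULift.up, ULift.up_injective⟩
    then I.lo else M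
  bot_lt σ h1 h2 := by
    rw [if_pos ⟨h1, h2⟩]
    exact EReal.bot_lt_coe _
  le_M σ h1 h2 := by
    rw [if_pos ⟨h1, h2⟩]
    exact I.lo_lt.le
  mono σ τ h1 h2 h3 := by
    rw [if_pos ⟨h1, h2.trans h3⟩, if_pos ⟨h1.mono h2, h3⟩]
  eq_M σ h := if_neg h

theorem mem_std {I : Interval M} {n : ℤ} {x : ULift.{u} ℕ} :
    x ∈ (std I n).carrier ↔ x.down < (n + 1).toNat := by
  simp only [std, Finset.mem_map, Finset.mem_range, Function.Embedding.coeFn_mk]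
  constructor
  · rintro ⟨a, ha, rfl⟩
    exact ha
  · intro h
    exact ⟨x.down, h, rfl⟩

theorem std_F {I : Interval M} {n : ℤ} {σ : Finset (ULift.{u} ℕ)} (h : σ.Nonempty)
    (h' : σ ⊆ (std I n).carrier) : (std I n).F σ = I.lo := if_pos ⟨h, h'⟩

theorem std_isSimplex (I : Interval M) {q : ℕ} {n : ℤ} (h : n = q) :
    (std.{u} I n).IsSimplex q I.lo := by
  refine ⟨?_, fun σ h1 h2 => std_F h1 h2⟩
  simp only [std, Finset.card_map, Finset.card_range]
  omega

theorem simplex_subset (X : FilteredSet M V) (σ : Finset X.carrier) :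
    X.simplex σ ⊆ X.carrier := by
  intro v hv
  simp only [simplex, Finset.mem_map, Function.Embedding.subtype_apply] at hv
  obtain ⟨a, -, rfl⟩ := hv
  exact a.2

/-- A map from a standard simplex whose image is small is filtration preserving. -/
theorem isFiltrationPreserving_std {I : Interval M} {n : ℤ} {X : FilteredSet M V}
    (f : (std.{u} I n).carrier → X.carrier) {t : List V} (ht : X.IsSmall I t)
    (hf : ∀ x, (f x).1 ∈ t) : IsFiltrationPreserving (std I n) X f := by
  intro σ hσ
  rw [std_F (σ := (std I n).simplex σ) hσ.map (simplex_subset _ _)]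
  refine (X.mono _ _ (hσ.image f).map ?_
    (nonempty_and_subset_of_lt (ht.trans_lt I.lo_lt)).2).trans ht
  intro v hv
  simp only [Finset.mem_map, Finset.mem_image, Function.Embedding.subtype_apply] at hv
  obtain ⟨_, ⟨a, -, rfl⟩, rfl⟩ := hv
  exact List.mem_toFinset.2 (hf a)

/-- The map of underlying sets given by a list of vertices. -/
def tupleMap {I : Interval M} {n : ℤ} {X : FilteredSet M V} {t : List V}
    (hn : (t.length : ℤ) = n + 1) (ht : X.IsSmall I t) (x : (std.{u} I n).carrier) :
    X.carrier :=
  have hx : x.1.down < t.length := by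
    have := mem_std.1 x.2
    omega
  ⟨t[x.1.down], ht.mem (List.getElem_mem hx)⟩

/-- A small list of `n + 1` vertices as a morphism from the standard simplex. -/
def tupleHom {I : Interval M} {n : ℤ} {X : FilteredSet M V} {t : List V}
    (hn : (t.length : ℤ) = n + 1) (ht : X.IsSmall I t) :
    RF.single (std.{u} I n) I ⟶ RF.single X I where
  interval_eq := rfl
  toFun := tupleMap hn ht
  mapsTo x hx := absurd hx (Finset.notMem_empty x.1)
  preserving := isFiltrationPreserving_std _ ht fun _ => List.getElem_mem _
  preserving_restrict := fun _ hσ => by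
    obtain ⟨a, -⟩ := hσ
    exact absurd a.2 (Finset.notMem_empty a.1)

/-- The list of the vertices of the standard simplex. -/
def stdList (n : ℤ) : List (ULift.{u} ℕ) := (List.finRange (n + 1).toNat).map fun i => ⟨i.1⟩

theorem stdList_eq (I : Interval M) (n : ℤ) :
    stdList.{u} n = ((List.finRange (n + 1).toNat).map fun i =>
      (⟨⟨i.1⟩, mem_std.2 i.2⟩ : (std I n).carrier)).map Subtype.val := by
  rw [List.map_map]
  rfl

theorem stdList_length {n : ℤ} (hn : 0 ≤ n) : ((stdList.{u} n).length : ℤ) = n + 1 := by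
  simp only [stdList, List.length_map, List.length_finRange]
  omega

theorem stdList_isSmall (I : Interval M) {n : ℤ} (hn : 0 ≤ n) :
    (std.{u} I n).IsSmall I (stdList n) := by
  obtain ⟨q, rfl⟩ := Int.eq_ofNat_of_zero_le hn
  refine Simplicial.isSmall_of_isSimplex (std_isSimplex I rfl) le_rfl (fun h => ?_) fun x hx => ?_
  · have := stdList_length.{u} hn
    rw [h, List.length_nil] at this
    omega
  · rw [stdList_eq I, List.mem_map] at hx
    obtain ⟨a, -, rfl⟩ := hx
    exact a.2

theorem stdList_mem_chains (I : Interval M) {n : ℤ} (hn : 0 ≤ n) :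
    Finsupp.single (stdList.{u} n) 1 ∈ (std I n).chains I n :=
  single_mem_chains (stdList_length hn) (stdList_isSmall I hn)

/-- Every small list is an image of the universal one, so natural identities need checking only on
`stdList`. -/
theorem chainMap_tupleMap {I : Interval M} {n : ℤ} {X : FilteredSet M V} {t : List V}
    (hn : (t.length : ℤ) = n + 1) (ht : X.IsSmall I t) :
    chainMap (tupleMap.{u} hn ht) (Finsupp.single (stdList n) 1) = Finsupp.single t 1 := by
  rw [stdList_eq I n, chainMap_single, List.map_map]
  congr 1
  refine List.ext_getElem ?_ fun i h1 h2 => ?_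
  · simp only [List.length_map, List.length_finRange]
    omega
  · simp [tupleMap]

end Standard

/-! ### Cellular chains -/

namespace Theory

variable {M : EReal} {V W : Type u}

/-- The pair of consecutive skeleta. -/
abbrev cellPair (X : FilteredSet M V) (I : Interval M) (n : ℤ) : RF.{u} M :=
  RF.pair (sk (n + 1) X) (sk n X) (sk_mono (IsSubset.refl X) (by omega)) I

/-- A morphism of pairs as a morphism of pairs of skeleta. -/
def skPair {X A : FilteredSet M V} {Y B : FilteredSet M W} {h : A.IsSubset X}
    {h' : B.IsSubset Y} {I : Interval M} (f : RF.pair X A h I ⟶ RF.pair Y B h' I) {c d : ℤ}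
    (hcd : d ≤ c) :
    RF.pair (sk c X) (sk d A) (sk_mono h hcd) I ⟶
      RF.pair (sk c Y) (sk d B) (sk_mono h' hcd) I where
  interval_eq := rfl
  toFun := RF.Hom.toFun (P := RF.pair X A h I) (Q := RF.pair Y B h' I) f
  mapsTo := RF.Hom.mapsTo (P := RF.pair X A h I) (Q := RF.pair Y B h' I) f
  preserving := (RF.Hom.preserving f).sk c
  preserving_restrict := (RF.Hom.preserving_restrict f).sk d

/-- A filtration preserving map as a morphism of absolute filtered sets. -/
def singleHom {X : FilteredSet M V} {Y : FilteredSet M W} (I : Interval M)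
    (f : X.carrier → Y.carrier) (hf : IsFiltrationPreserving X Y f) :
    RF.single X I ⟶ RF.single Y I where
  interval_eq := rfl
  toFun := f
  mapsTo x hx := absurd hx (Finset.notMem_empty x.1)
  preserving := hf
  preserving_restrict := fun _ hσ => by
    obtain ⟨a, -⟩ := hσ
    exact absurd a.2 (Finset.notMem_empty a.1)

/-- A filtration preserving map as a morphism of skeleta. -/
def skSingle {X : FilteredSet M V} {Y : FilteredSet M W} {I : Interval M}
    (f : RF.single X I ⟶ RF.single Y I) (c : ℤ) :
    RF.single (sk c X) I ⟶ RF.single (sk c Y) I :=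
  singleHom I (RF.Hom.toFun f) ((RF.Hom.preserving f).sk c)

/-- A filtration preserving map as a morphism of pairs of consecutive skeleta. -/
def cellHom {X : FilteredSet M V} {Y : FilteredSet M W} {I : Interval M}
    (f : RF.single X I ⟶ RF.single Y I) (n : ℤ) : cellPair X I n ⟶ cellPair Y I n where
  interval_eq := rfl
  toFun := RF.Hom.toFun (P := RF.single X I) (Q := RF.single Y I) f
  mapsTo x _ := (RF.Hom.toFun f x).2
  preserving := (RF.Hom.preserving f).sk (n + 1)
  preserving_restrict := (RF.Hom.preserving f).sk n

variable (T : Theory.{u} M) (I : Interval M)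

/-- The group of cellular chains of degree `n`. -/
abbrev Cell (X : FilteredSet M V) (n : ℤ) : Type u := (T.H n).obj (cellPair X I n)

/-- The map from the homology of the skeleton to cellular chains. -/
def toCell (X : FilteredSet M V) (n : ℤ) :
    (T.H n).obj (RF.single (sk (n + 1) X) I) →+ T.Cell I X n :=
  T.hom n (inclPair _ I)

/-- The boundary of cellular chains as a map to the homology of the skeleton. -/
def cellBd (X : FilteredSet M V) (n : ℤ) :
    T.Cell I X (n + 1) →+ (T.H n).obj (RF.single (sk (n + 1) X) I) :=
  T.bdHom n (cellPair X I (n + 1))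

variable {T I}

theorem cellHom_toCell {X : FilteredSet M V} {Y : FilteredSet M W}
    (f : RF.single X I ⟶ RF.single Y I) (n : ℤ) (x : (T.H n).obj (RF.single (sk (n + 1) X) I)) :
    T.hom n (cellHom f n) (toCell T I X n x) =
      toCell T I Y n (T.hom n (skSingle f (n + 1)) x) := by
  rw [toCell, toCell, hom_hom, hom_hom]
  refine hom_congr (fun _ => ?_) x
  rfl

theorem cellBd_cellHom {X : FilteredSet M V} {Y : FilteredSet M W}
    (f : RF.single X I ⟶ RF.single Y I) (n : ℤ) (x : T.Cell I X (n + 1)) :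
    cellBd T I Y n (T.hom (n + 1) (cellHom f (n + 1)) x) =
      T.hom n (skSingle f (n + 1)) (cellBd T I X n x) := by
  rw [cellBd, bdHom_hom]
  refine hom_congr (fun _ => ?_) _
  rfl

/-- The cellular chain of an ordered chain with respect to a choice of a class of the standard
simplex. -/
def psi (X : FilteredSet M V) {n : ℤ} (a : T.Cell I (std I n) n) :
    Chains V →ₗ[ℤ] T.Cell I X n :=
  Finsupp.linearCombination ℤ fun t =>
    if h : (t.length : ℤ) = n + 1 ∧ X.IsSmall I t then
      T.hom n (cellHom (tupleHom h.1 h.2) n) a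
    else 0

theorem psi_single {X : FilteredSet M V} {n : ℤ} (a : T.Cell I (std I n) n) {t : List V}
    (hn : (t.length : ℤ) = n + 1) (ht : X.IsSmall I t) :
    psi X a (Finsupp.single t 1) = T.hom n (cellHom (tupleHom hn ht) n) a := by
  rw [psi, Finsupp.linearCombination_single, one_smul, dif_pos ⟨hn, ht⟩]

/-- The morphism of a tuple followed by `f` is the morphism of the image tuple. -/
theorem hom_psi {X : FilteredSet M V} {Y : FilteredSet M W} {n : ℤ}
    (a : T.Cell I (std I n) n) (f : RF.single X I ⟶ RF.single Y I) {c : Chains V}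
    (hc : c ∈ X.chains I n) :
    T.hom n (cellHom f n) (psi X a c) = psi Y a (Simplicial.homChainMap f c) := by
  refine eqOn_supported (f := (T.hom n (cellHom f n)).toIntLinearMap ∘ₗ psi X a)
    (g := psi Y a ∘ₗ Simplicial.homChainMap f) (fun t ht => ?_) hc
  obtain ⟨s, rfl⟩ := ht.2.exists_list
  simp only [LinearMap.comp_apply, AddMonoidHom.coe_toIntLinearMap]
  rw [psi_single a ht.1 ht.2, Simplicial.homChainMap, chainMap_single,
    psi_single a (by simpa using ht.1) (ht.2.map (RF.Hom.preserving f)), hom_hom]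
  refine hom_congr (fun (x : (std I n).carrier) => Subtype.ext ?_) a
  have hx : x.1.down < s.length := by
    have h1 := mem_std.1 x.2
    have h2 : ((s.map Subtype.val).length : ℤ) = n + 1 := ht.1
    rw [List.length_map] at h2
    omega
  have e : tupleMap ht.1 ht.2 x = s[x.1.down] := Subtype.ext (by simp [tupleMap])
  refine (congrArg (fun z => (RF.Hom.toFun f z).1) e).trans ?_
  exact (List.getElem_map (fun z => (RF.Hom.toFun f z).1)).symm

/-- The condition that `b` is a class of the standard simplex whose boundary is the sum of the
faces with respect to the class `a`. -/
def Compatible {n : ℤ} (a : T.Cell I (std I n) n) (b : T.Cell I (std I (n + 1)) (n + 1)) : Prop :=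
  toCell T I _ n (cellBd T I _ n b) = psi _ a (bdry (Finsupp.single (stdList (n + 1)) 1))

/-- Compatibility concerns the standard simplex only; naturality along `tupleHom` carries it to all
filtered sets, making `psi` a chain map. -/
theorem toCell_cellBd_psi {n : ℤ} {a : T.Cell I (std I n) n}
    {b : T.Cell I (std I (n + 1)) (n + 1)} (hab : Compatible a b) {X : FilteredSet M V}
    {c : Chains V} (hc : c ∈ X.chains I (n + 1)) :
    toCell T I X n (cellBd T I X n (psi X b c)) = psi X a (bdry c) := by
  refine eqOn_supported
    (f := (toCell T I X n).toIntLinearMap ∘ₗ (cellBd T I X n).toIntLinearMap ∘ₗ psi X b)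
    (g := psi X a ∘ₗ bdry) (fun t ht => ?_) hc
  simp only [LinearMap.comp_apply, AddMonoidHom.coe_toIntLinearMap]
  have hn : 0 ≤ n + 1 := by
    have h1 := List.length_pos_of_ne_nil ht.2.ne_nil
    have h2 := ht.1
    omega
  have hs := stdList_mem_chains.{u} I hn
  rw [psi_single b ht.1 ht.2, cellBd_cellHom, ← cellHom_toCell, hab,
    hom_psi _ _ (bdry_mem_chains_succ hs), Simplicial.homChainMap_bdry _ hs]
  congr 2
  exact chainMap_tupleMap ht.1 ht.2

/-- The simplex has `n + 1` points, so these skeleta lose nothing and the simplex axiom applies to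
them. -/
theorem sk_std_isSimplex (I : Interval M) {q : ℕ} {n c : ℤ} (h : n = q) (hc : n + 1 ≤ c) :
    (sk c (std.{u} I n)).IsSimplex q I.lo := by
  have hS := std_isSimplex.{u} I h
  refine ⟨hS.1, fun σ h1 h2 => ?_⟩
  have h3 := Finset.card_le_card h2
  have h4 : σ.card ≤ q + 1 := h3.trans_eq hS.1
  have : (sk c (std I n)).F σ = (std I n).F σ := if_pos (by omega)
  rw [this]
  exact hS.2 σ h1 h2

section Axioms

variable (hT : T.SatisfiesAxioms)
include hT

/-- The kernel comes from `H_n (sk n X)`, which vanishes because `sk n X` has dimension at most `n -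
1`. -/
theorem toCell_injective (X : FilteredSet M V) (n : ℤ) :
    Function.Injective (toCell T I X n) := by
  rw [injective_iff_map_eq_zero]
  intro x hx
  obtain ⟨y, rfl⟩ := (exact_hom_hom hT _ I n x).1 hx
  have := subsingleton_sk hT I X (c := n) (k := n) (Or.inl le_rfl)
  rw [Subsingleton.elim y 0, map_zero]

theorem exists_toCell_eq (X : FilteredSet M V) {n : ℤ} {x : T.Cell I X (n + 1)}
    (hx : cellBd T I X n x = 0) : ∃ y, toCell T I X (n + 1) y = x :=
  (exact_hom_bdHom hT _ I n x).1 hx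

theorem exists_cellBd_eq (X : FilteredSet M V) {n : ℤ}
    {y : (T.H n).obj (RF.single (sk (n + 1) X) I)}
    (hy : T.hom n (inclSingle (sk_mono (IsSubset.refl X) (by omega : n + 1 ≤ n + 1 + 1)) I) y = 0) :
    ∃ x, cellBd T I X n x = y :=
  (exact_bdHom_hom hT _ I n y).1 hy

/-- This is where the coherence of the identifications with `ℤ` enters: one class of the point goes
to `1` under every map to a small simplex. -/
theorem exists_generator (I : Interval M) : ∃ u : (T.H 0).obj (RF.single (std I 0) I),
    ∀ {V : Type u} (S : FilteredSet M V) (q : ℕ) (α : EReal), S.IsSimplex q α → α ≤ I.lo →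
      ∃ φ : (T.H 0).obj (RF.single S I) ≃+ ℤ,
        ∀ f : RF.single (std I 0) I ⟶ RF.single S I, φ (T.hom 0 f u) = 1 := by
  obtain ⟨φ, hφ⟩ := (hT.2.2 I).2
  have h0 := std_isSimplex.{u} I (q := 0) (n := 0) rfl
  refine ⟨(φ _ _ 0 _ h0 le_rfl).symm 1, fun {V} S q α hS hα => ⟨φ V S q α hS hα, fun f => ?_⟩⟩
  refine (hφ _ _ _ _ _ _ _ _ h0 hS le_rfl hα f _).trans ?_
  simp

end Axioms

end Theory

/-! ### Fundamental classes -/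

namespace FilteredSet

variable {M : EReal} {V : Type u}

theorem IsSmall.sk {X : FilteredSet M V} {I : Interval M} {t : List V} (h : X.IsSmall I t)
    {c : ℤ} (hc : (t.length : ℤ) ≤ c) : (sk c X).IsSmall I t := by
  have h1 := t.toFinset_card_le
  have : (FilteredSet.sk c X).F t.toFinset = X.F t.toFinset := if_pos (by omega)
  exact this.le.trans h

end FilteredSet

namespace Theory

variable {M : EReal} {T : Theory.{u} M} {I : Interval M} {V W : Type u}

/-- A vertex as a morphism from the standard point. -/
def vertexHom (X : FilteredSet M V) {v : V} (hv : X.IsSmall I [v]) :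
    RF.single (std.{u} I 0) I ⟶ RF.single X I :=
  tupleHom (by simp) hv

theorem vertexHom_toFun {X : FilteredSet M V} {v : V} (hv : X.IsSmall I [v])
    (x : (std.{u} I 0).carrier) : (RF.Hom.toFun (vertexHom X hv) x).1 = v :=
  List.getElem_singleton _

theorem zero_isSmall (I : Interval M) : (std.{u} I 0).IsSmall I [ULift.up 0] :=
  stdList_isSmall I le_rfl

/-- The cellular chain given by a homology class of the standard point. -/
def pointCell (T : Theory.{u} M) (I : Interval M) (u : (T.H 0).obj (RF.single (std I 0) I)) :
    T.Cell I (std I 0) 0 :=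
  toCell T I _ 0 (T.hom 0 (vertexHom (sk (0 + 1) (std I 0)) ((zero_isSmall I).sk (by simp))) u)

theorem psi_vertex (u : (T.H 0).obj (RF.single (std I 0) I)) {X : FilteredSet M V} {v : V}
    (hv : X.IsSmall I [v]) :
    psi X (pointCell T I u) (Finsupp.single [v] 1) =
      toCell T I X 0 (T.hom 0 (vertexHom (sk (0 + 1) X) (hv.sk (by simp))) u) := by
  rw [psi_single _ (by simp) hv, pointCell, cellHom_toCell, hom_hom]
  congr 1
  refine hom_congr (fun x => Subtype.ext ?_) u
  rw [vertexHom_toFun]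
  exact List.getElem_singleton _

section Axioms

variable (hT : T.SatisfiesAxioms)
include hT

theorem exists_compatible_of {n : ℤ} {a : T.Cell I (std I n) n}
    {y : (T.H n).obj (RF.single (sk (n + 1) (std I (n + 1))) I)}
    (hy : toCell T I _ n y = psi _ a (bdry (Finsupp.single (stdList (n + 1)) 1)))
    (hy' : T.hom n (inclSingle (sk_mono (IsSubset.refl _)
      (by omega : n + 1 ≤ n + 1 + 1)) I) y = 0) :
    ∃ b : T.Cell I (std I (n + 1)) (n + 1), Compatible a b := by
  obtain ⟨b, hb⟩ := exists_cellBd_eq hT _ hy'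
  exact ⟨b, by rw [Compatible, hb, hy]⟩

/-- The sum of faces is a cellular cycle because `∂∂ = 0`, so it lifts to the homology of the
skeleton. There it bounds, since the homology of the full simplex is zero in degree `n + 1 > 0`. -/
theorem exists_compatible_succ {n : ℤ} (hn : 0 ≤ n) {a : T.Cell I (std I n) n}
    {b : T.Cell I (std I (n + 1)) (n + 1)} (hab : Compatible a b) :
    ∃ c : T.Cell I (std I (n + 1 + 1)) (n + 1 + 1), Compatible b c := by
  have hs := stdList_mem_chains.{u} I (n := n + 1 + 1) (by omega)
  obtain ⟨y, hy⟩ := exists_toCell_eq hT (std.{u} I (n + 1 + 1))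
    (x := psi _ b (bdry (Finsupp.single (stdList (n + 1 + 1)) 1))) (by
      apply toCell_injective hT
      rw [toCell_cellBd_psi hab (bdry_mem_chains_succ hs), bdry_bdry, map_zero, map_zero])
  refine exists_compatible_of hT hy ?_
  have hsimp : (sk (n + 1 + 1 + 1) (std.{u} I (n + 1 + 1))).IsSimplex (n + 1 + 1).toNat I.lo :=
    sk_std_isSimplex I (by omega) le_rfl
  have := (hT.2.2 I).1 _ _ _ _ (n + 1) hsimp (by omega)
  exact Subsingleton.elim _ _

/-- In degree zero the homology of the edge does not vanish. The difference of its ends still does,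
as both vertices carry the image of the same generator `u`. -/
theorem exists_compatible_zero {u : (T.H 0).obj (RF.single (std I 0) I)}
    (hu : ∀ {V : Type u} (S : FilteredSet M V) (q : ℕ) (α : EReal), S.IsSimplex q α → α ≤ I.lo →
      ∃ φ : (T.H 0).obj (RF.single S I) ≃+ ℤ,
        ∀ f : RF.single (std I 0) I ⟶ RF.single S I, φ (T.hom 0 f u) = 1) :
    ∃ b : T.Cell I (std I (0 + 1)) (0 + 1), Compatible (pointCell T I u) b := by
  have hs : stdList.{u} (0 + 1) = [ULift.up 0, ULift.up 1] := rfl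
  have hsm := stdList_isSmall.{u} I (n := 0 + 1) (by omega)
  rw [hs] at hsm
  have h0 : (std.{u} I (0 + 1)).IsSmall I [ULift.up 0] := hsm.of_subset (by simp) (by simp)
  have h1 : (std.{u} I (0 + 1)).IsSmall I [ULift.up 1] := hsm.of_subset (by simp) (by simp)
  have hb : bdry (Finsupp.single (stdList.{u} (0 + 1)) 1) =
      Finsupp.single [ULift.up 1] 1 - Finsupp.single [ULift.up 0] 1 := by
    rw [hs, bdry_apply, augBdry_single]
    simp [augBdryList]
  refine exists_compatible_of hT (y := T.hom 0 (vertexHom (sk (0 + 1) _) (h1.sk (by simp))) u -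
    T.hom 0 (vertexHom (sk (0 + 1) _) (h0.sk (by simp))) u) ?_ ?_
  · rw [hb, map_sub, map_sub, psi_vertex _ h1, psi_vertex _ h0]
  · obtain ⟨φ, hφ⟩ := hu _ 1 I.lo
      (sk_std_isSimplex.{u} I (q := 1) (n := 0 + 1) rfl (c := 0 + 1 + 1) le_rfl) le_rfl
    apply φ.injective
    rw [map_sub, hom_hom, hom_hom, map_sub, hφ, hφ, map_zero, sub_self]

end Axioms

/-- A choice of classes of the standard simplices that define a map from ordered chains to
cellular chains. -/
structure Fundamental (T : Theory.{u} M) (I : Interval M) where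
  cls : ∀ n : ℤ, T.Cell I (std I n) n
  toCell_cellBd : ∀ {V : Type u} (X : FilteredSet M V) (n : ℤ) (c : Chains V),
    c ∈ X.chains I (n + 1) →
      toCell T I X n (cellBd T I X n (psi X (cls (n + 1)) c)) = psi X (cls n) (bdry c)
  gen : (T.H 0).obj (RF.single (std I 0) I)
  cls_zero : cls 0 = pointCell T I gen
  generates : ∀ {V : Type u} (S : FilteredSet M V) (q : ℕ) (α : EReal), S.IsSimplex q α →
    α ≤ I.lo → ∃ φ : (T.H 0).obj (RF.single S I) ≃+ ℤ,
      ∀ f : RF.single (std I 0) I ⟶ RF.single S I, φ (T.hom 0 f gen) = 1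

/-- A sequence of compatible classes of the standard simplices. -/
def compatibleSeq (hT : T.SatisfiesAxioms) {a : T.Cell I (std I 0) 0}
    {b : T.Cell I (std I (0 + 1)) (0 + 1)} (hab : Compatible a b) :
    ∀ q : ℕ, {p : T.Cell I (std I q) q × T.Cell I (std I ((q : ℤ) + 1)) ((q : ℤ) + 1) //
      Compatible p.1 p.2}
  | 0 => ⟨(a, b), hab⟩
  | q + 1 =>
    let p := compatibleSeq hT hab q
    have h := exists_compatible_succ hT (Int.natCast_nonneg q) p.2
    ⟨(p.1.2, h.choose), h.choose_spec⟩

theorem exists_fundamental (hT : T.SatisfiesAxioms) (I : Interval M) :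
    Nonempty (Fundamental T I) := by
  obtain ⟨u, hu⟩ := exists_generator hT I
  obtain ⟨b, hab⟩ := exists_compatible_zero hT hu
  let s := compatibleSeq hT hab
  refine ⟨⟨fun n => match n with
    | Int.ofNat q => (s q).1.1
    | Int.negSucc _ => 0, ?_, u, rfl, hu⟩⟩
  intro V X n c hc
  rcases n with q | q
  -- The second class of `s q` is by definition the first class of `s (q + 1)`.
  · exact toCell_cellBd_psi (s q).2 hc
  -- In negative degree `n` both sides are zero: `sk (n + 1) X` has no small simplices, and there
  -- are no chains.
  · have h1 := subsingleton_sk hT I X (c := Int.negSucc q + 1) (k := Int.negSucc q)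
      (Or.inr (by omega))
    have h2 := bdry_mem_chains_succ hc
    rw [chains_eq_bot_of_neg _ _ (Int.negSucc_lt_zero q), Submodule.mem_bot] at h2
    rw [h2, map_zero]
    exact (congrArg _ (Subsingleton.elim _ 0)).trans (map_zero _)

end Theory

/-! ### The comparison with simplicial homology -/

namespace Theory

variable {M : EReal} {T : Theory.{u} M} {I : Interval M} {V W : Type u}

/-- The pair of skeleta in which the homology class of a relative cycle of degree `n + 1` is
constructed. -/
abbrev skPairObj {X A : FilteredSet M V} (h : A.IsSubset X) (I : Interval M) (n : ℤ) : RF.{u} M :=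
  RF.pair (sk (n + 1 + 1) X) (sk (n + 1) A) (sk_mono h (by omega)) I

/-- The inclusion into the pair of consecutive skeleta. -/
def skPairToCell {X A : FilteredSet M V} (h : A.IsSubset X) (I : Interval M) (n : ℤ) :
    skPairObj h I n ⟶ cellPair X I (n + 1) :=
  RF.incl _ _ (IsSubset.refl _) (sk_mono h le_rfl) I

/-- The inclusion of the pair of skeleta. -/
def skPairIncl {X A : FilteredSet M V} (h : A.IsSubset X) (I : Interval M) (n : ℤ) :
    skPairObj h I n ⟶ RF.pair X A h I :=
  RF.incl _ _ (sk_isSubset _ _) (sk_isSubset _ _) I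

/-- The boundary homomorphism of the pair of skeleta. -/
def skPairBd (T : Theory.{u} M) {X A : FilteredSet M V} (h : A.IsSubset X) (I : Interval M)
    (n : ℤ) :
    (T.H (n + 1)).obj (skPairObj h I n) →+ (T.H n).obj (RF.single (sk (n + 1) A) I) :=
  T.bdHom n (skPairObj h I n)

/-- The class `x` represents the relative cycle `z`. -/
structure Represents (Φ : Fundamental T I) {X A : FilteredSet M V} (h : A.IsSubset X) (n : ℤ)
    (z : Chains V) (x : (T.H (n + 1)).obj (skPairObj h I n)) : Prop where
  bd : toCell T I A n (skPairBd T h I n x) = psi A (Φ.cls n) (bdry z)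
  cell : T.hom (n + 1) (skPairToCell h I n) x = psi X (Φ.cls (n + 1)) z

theorem cellBd_skPairToCell {X A : FilteredSet M V} (h : A.IsSubset X) (n : ℤ)
    (x : (T.H (n + 1)).obj (skPairObj h I n)) :
    cellBd T I X n (T.hom (n + 1) (skPairToCell h I n) x) =
      T.hom n (inclSingle (sk_mono h le_rfl) I) (skPairBd T h I n x) := by
  rw [cellBd, bdHom_hom]
  refine hom_congr (fun _ => ?_) _
  rfl

theorem skPairToCell_inclPair {X A : FilteredSet M V} (h : A.IsSubset X) (n : ℤ)
    (w : (T.H (n + 1)).obj (RF.single (sk (n + 1 + 1) X) I)) :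
    T.hom (n + 1) (skPairToCell h I n) (T.hom (n + 1) (inclPair _ I) w) =
      toCell T I X (n + 1) w := by
  rw [hom_hom]
  refine hom_congr (fun _ => ?_) _
  rfl

namespace Represents

variable {Φ : Fundamental T I} {X A : FilteredSet M V} {h : A.IsSubset X} {n : ℤ}

theorem add {z z' : Chains V} {x x' : (T.H (n + 1)).obj (skPairObj h I n)}
    (hx : Represents Φ h n z x) (hx' : Represents Φ h n z' x') :
    Represents Φ h n (z + z') (x + x') :=
  ⟨by simp only [map_add, hx.bd, hx'.bd], by simp only [map_add, hx.cell, hx'.cell]⟩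

theorem sub {z z' : Chains V} {x x' : (T.H (n + 1)).obj (skPairObj h I n)}
    (hx : Represents Φ h n z x) (hx' : Represents Φ h n z' x') :
    Represents Φ h n (z - z') (x - x') :=
  ⟨by simp only [map_sub, hx.bd, hx'.bd], by simp only [map_sub, hx.cell, hx'.cell]⟩

theorem map {Y B : FilteredSet M W} {h' : B.IsSubset Y}
    (f : RF.pair X A h I ⟶ RF.pair Y B h' I) {z : Chains V}
    {x : (T.H (n + 1)).obj (skPairObj h I n)} (hz : z ∈ Simplicial.cycles (RF.pair X A h I) (n + 1))
    (hx : Represents Φ h n z x) :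
    Represents Φ h' n (Simplicial.homChainMap f z)
      (T.hom (n + 1) (skPair f (by omega : n + 1 ≤ n + 1 + 1)) x) := by
  have hz1 : z ∈ X.chains I (n + 1) := (Simplicial.mem_cycles_succ.1 hz).1
  have hz2 : bdry z ∈ A.chains I n := (Simplicial.mem_cycles_succ.1 hz).2
  constructor
  · let g : RF.single A I ⟶ RF.single B I := Simplicial.restrictHom f
    have e1 : skPairBd T h' I n (T.hom (n + 1) (skPair f (by omega : n + 1 ≤ n + 1 + 1)) x) =
        T.hom n (skSingle g (n + 1)) (skPairBd T h I n x) := by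
      rw [skPairBd, bdHom_hom]
      refine hom_congr (fun _ => ?_) _
      rfl
    have e2 := cellHom_toCell g n (skPairBd T h I n x)
    have e3 : Simplicial.homChainMap g (bdry z) = bdry (Simplicial.homChainMap f z) :=
      (Simplicial.chainMap_restrict f hz2).trans (Simplicial.homChainMap_bdry f hz1)
    rw [hx.bd, hom_psi _ _ hz2, e3] at e2
    rw [e1, ← e2]
  · let g : RF.single X I ⟶ RF.single Y I :=
      singleHom I (RF.Hom.toFun f) (RF.Hom.preserving f)
    have e1 : T.hom (n + 1) (skPairToCell h' I n)
        (T.hom (n + 1) (skPair f (by omega : n + 1 ≤ n + 1 + 1)) x) =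
        T.hom (n + 1) (cellHom g (n + 1)) (T.hom (n + 1) (skPairToCell h I n) x) := by
      rw [hom_hom, hom_hom]
      refine hom_congr (fun _ => ?_) _
      rfl
    rw [e1, hx.cell]
    exact hom_psi _ g hz1

section Axioms

variable (hT : T.SatisfiesAxioms)
include hT

/-- Zero boundary makes `x` come from `H_{n+1} (sk (n + 2) X)`, and that group embeds in cellular
chains, where the preimage is zero. -/
theorem eq_zero {x : (T.H (n + 1)).obj (skPairObj h I n)} (hx : Represents Φ h n 0 x) :
    x = 0 := by
  have h1 : skPairBd T h I n x = 0 := by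
    apply toCell_injective hT
    rw [hx.bd, map_zero, map_zero, map_zero]
  obtain ⟨w, rfl⟩ := (exact_hom_bdHom hT _ I n x).1 h1
  have h2 := hx.cell
  rw [skPairToCell_inclPair, map_zero] at h2
  rw [toCell_injective hT X (n + 1) (h2.trans (map_zero _).symm), map_zero]

theorem unique {z : Chains V} {x x' : (T.H (n + 1)).obj (skPairObj h I n)}
    (hx : Represents Φ h n z x) (hx' : Represents Φ h n z x') : x = x' := by
  have := hx.sub hx'
  rw [sub_self] at this
  exact sub_eq_zero.1 (this.eq_zero hT)

end Axioms

end Represents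

section Axioms

variable (hT : T.SatisfiesAxioms)
include hT

/-- A cellular chain that comes from a cycle lifts to the homology of the skeleton. -/
theorem exists_lift_of_cycle (Φ : Fundamental T I) {A : FilteredSet M V} {n : ℤ} {c : Chains V}
    (hc : c ∈ A.chains I n) (hc' : bdry c = 0) :
    ∃ y, toCell T I A n y = psi A (Φ.cls n) c := by
  obtain ⟨n, rfl⟩ : ∃ m, n = m + 1 := ⟨n - 1, by omega⟩
  apply exists_toCell_eq hT
  apply toCell_injective hT
  rw [Φ.toCell_cellBd A n c hc, hc', map_zero, map_zero]

theorem exists_represents (Φ : Fundamental T I) {X A : FilteredSet M V} (h : A.IsSubset X)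
    {n : ℤ} {z : Chains V} (hz : z ∈ Simplicial.cycles (RF.pair X A h I) (n + 1)) :
    ∃ x, Represents Φ h n z x := by
  have hz1 : z ∈ X.chains I (n + 1) := (Simplicial.mem_cycles_succ.1 hz).1
  have hz2 : bdry z ∈ A.chains I n := (Simplicial.mem_cycles_succ.1 hz).2
  obtain ⟨y, hy⟩ := exists_lift_of_cycle hT Φ hz2 (bdry_bdry z)
  -- In `X` the lift `y` of `psi (∂z)` is the cellular boundary of `psi z`, both having the same
  -- image in cellular chains. Hence `y` dies in `sk (n + 2) X` and is the boundary of some `x`.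
  have e1 : T.hom n (inclSingle (sk_mono h le_rfl) I) y =
      cellBd T I X n (psi X (Φ.cls (n + 1)) z) := by
    apply toCell_injective hT
    rw [Φ.toCell_cellBd X n z hz1]
    have e := cellHom_toCell (inclSingle h I) n y
    rw [hy, hom_psi _ _ hz2, inclSingle, Simplicial.homChainMap_incl _ _ _ _ _ hz2] at e
    exact e.symm
  have e2 : T.hom n (inclSingle (sk_mono h (by omega : n + 1 ≤ n + 1 + 1)) I) y = 0 := by
    have e := (exact_bdHom_hom hT (sk_mono (IsSubset.refl X) (by omega : n + 1 ≤ n + 1 + 1))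
      I n _).2 ⟨psi X (Φ.cls (n + 1)) z, e1.symm⟩
    rw [hom_hom] at e
    exact e
  obtain ⟨x, hx'⟩ : ∃ x, skPairBd T h I n x = y := (exact_bdHom_hom hT _ I n y).1 e2
  -- The cellular chain of `x` may differ from `psi z`, but the difference is a cycle. Subtracting
  -- its lift `w` corrects this without changing the boundary of `x`.
  obtain ⟨w, hw⟩ := exists_toCell_eq hT X
    (x := T.hom (n + 1) (skPairToCell h I n) x - psi X (Φ.cls (n + 1)) z) (by
      rw [map_sub, cellBd_skPairToCell, hx', e1, sub_self])
  refine ⟨x - T.hom (n + 1) (inclPair _ I) w, ?_, ?_⟩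
  · have e : skPairBd T h I n (T.hom (n + 1) (inclPair _ I) w) = 0 :=
      (exact_hom_bdHom hT _ I n _).2 ⟨w, rfl⟩
    rw [map_sub, e, sub_zero, hx', hy]
  · rw [map_sub, skPairToCell_inclPair, hw]
    abel

theorem subsingleton_pair_self (A : FilteredSet M V) (n : ℤ) :
    Subsingleton ((T.H (n + 1)).obj (RF.pair A A (IsSubset.refl A) I)) := by
  refine subsingleton_of_eq_zero fun x => ?_
  have hi : ∀ k (y : (T.H k).obj (RF.single A I)),
      T.hom k (inclSingle (IsSubset.refl A) I) y = y := fun k y => hom_id y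
  have h1 : T.bdHom n _ x = 0 := by
    rw [← hi n (T.bdHom n _ x)]
    exact (exact_bdHom_hom hT (IsSubset.refl A) I n _).2 ⟨x, rfl⟩
  obtain ⟨w, rfl⟩ := (exact_hom_bdHom hT _ I n x).1 h1
  exact (exact_hom_hom hT (IsSubset.refl A) I (n + 1) w).2 ⟨w, hi _ w⟩

/-- The part `∂w` is represented by a class that bounds in `sk (n + 3) X`, and the part `a` by a
class whose image factors through the pair `(A, A)`, which has no homology. By uniqueness `x` is the
sum of the two. -/
theorem skPairIncl_eq_zero {Φ : Fundamental T I} {X A : FilteredSet M V} {h : A.IsSubset X}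
    {n : ℤ} {z : Chains V} {x : (T.H (n + 1)).obj (skPairObj h I n)}
    (hx : Represents Φ h n z x) (hz : z ∈ Simplicial.boundaries (RF.pair X A h I) (n + 1)) :
    T.hom (n + 1) (skPairIncl h I n) x = 0 := by
  obtain ⟨w, hw, a, ha, rfl⟩ := Simplicial.mem_boundaries.1 hz
  dsimp only at hw ha
  let y := cellBd T I X (n + 1) (psi X (Φ.cls (n + 1 + 1)) w)
  have h1 : Represents Φ h n (bdry w) (T.hom (n + 1) (inclPair _ I) y) := by
    constructor
    · have e : skPairBd T h I n (T.hom (n + 1) (inclPair _ I) y) = 0 :=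
        (exact_hom_bdHom hT _ I n _).2 ⟨y, rfl⟩
      rw [e, bdry_bdry, map_zero, map_zero]
    · rw [skPairToCell_inclPair, Φ.toCell_cellBd X (n + 1) w hw]
  let g : cellPair A I (n + 1) ⟶ skPairObj h I n :=
    RF.incl _ _ (sk_mono h le_rfl) (IsSubset.refl _) I
  have h2 : Represents Φ h n a (T.hom (n + 1) g (psi A (Φ.cls (n + 1)) a)) := by
    constructor
    · have e : skPairBd T h I n (T.hom (n + 1) g (psi A (Φ.cls (n + 1)) a)) =
          cellBd T I A n (psi A (Φ.cls (n + 1)) a) := by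
        rw [skPairBd, bdHom_hom]
        exact hom_id _
      rw [e, Φ.toCell_cellBd A n a ha]
    · rw [hom_hom]
      have e := hom_psi (Φ.cls (n + 1)) (inclSingle h I) ha
      rw [inclSingle, Simplicial.homChainMap_incl _ _ _ _ _ ha] at e
      rw [← e]
      refine hom_congr (fun _ => ?_) _
      rfl
  rw [hx.unique hT (h1.add h2), map_add]
  have z1 : T.hom (n + 1) (skPairIncl h I n) (T.hom (n + 1) (inclPair _ I) y) = 0 := by
    have e := (exact_bdHom_hom hT
      (sk_mono (IsSubset.refl X) (by omega : n + 1 + 1 ≤ n + 1 + 1 + 1)) I (n + 1) y).2 ⟨_, rfl⟩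
    have e' : T.hom (n + 1) (skPairIncl h I n) (T.hom (n + 1) (inclPair _ I) y) =
        T.hom (n + 1) (inclPair h I) (T.hom (n + 1) (inclSingle (sk_isSubset _ X) I)
          (T.hom (n + 1) (inclSingle (sk_mono (IsSubset.refl X)
            (by omega : n + 1 + 1 ≤ n + 1 + 1 + 1)) I) y)) := by
      rw [hom_hom, hom_hom, hom_hom]
      refine hom_congr (fun _ => ?_) _
      rfl
    rw [e', e, map_zero, map_zero]
  have z2 : T.hom (n + 1) (skPairIncl h I n) (T.hom (n + 1) g (psi A (Φ.cls (n + 1)) a)) = 0 := by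
    let g₁ : cellPair A I (n + 1) ⟶ RF.pair A A (IsSubset.refl A) I :=
      RF.incl _ _ (sk_isSubset _ _) (sk_isSubset _ _) I
    let g₂ : RF.pair A A (IsSubset.refl A) I ⟶ RF.pair X A h I :=
      RF.incl _ _ h (IsSubset.refl A) I
    have e' : T.hom (n + 1) (skPairIncl h I n) (T.hom (n + 1) g (psi A (Φ.cls (n + 1)) a)) =
        T.hom (n + 1) g₂ (T.hom (n + 1) g₁ (psi A (Φ.cls (n + 1)) a)) := by
      rw [hom_hom, hom_hom]
      refine hom_congr (fun _ => ?_) _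
      rfl
    have := subsingleton_pair_self hT (I := I) A n
    rw [e', Subsingleton.elim (T.hom (n + 1) g₁ _) 0, map_zero]
  rw [z1, z2, add_zero]

end Axioms

/-- The comparison map from simplicial homology in degree `n + 1`. -/
def theta (hT : T.SatisfiesAxioms) (Φ : Fundamental T I) {X A : FilteredSet M V}
    (h : A.IsSubset X) (n : ℤ) :
    Simplicial.Homology (RF.pair X A h I) (n + 1) →+ (T.H (n + 1)).obj (RF.pair X A h I) :=
  Simplicial.lift
    (AddMonoidHom.mk'
      (fun z => T.hom (n + 1) (skPairIncl h I n) (exists_represents hT Φ h z.2).choose)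
      (fun z z' => by
        -- The chosen representing classes add up because they are unique.
        rw [← map_add]
        congr 1
        exact (exists_represents hT Φ h (z + z').2).choose_spec.unique hT
          ((exists_represents hT Φ h z.2).choose_spec.add
            (exists_represents hT Φ h z'.2).choose_spec)))
    (fun z hz => skPairIncl_eq_zero hT (exists_represents hT Φ h z.2).choose_spec hz)

section Axioms

variable (hT : T.SatisfiesAxioms) (Φ : Fundamental T I)

theorem theta_cls {X A : FilteredSet M V} (h : A.IsSubset X) {n : ℤ} {z : Chains V}
    (hz : z ∈ Simplicial.cycles (RF.pair X A h I) (n + 1))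
    {x : (T.H (n + 1)).obj (skPairObj h I n)} (hx : Represents Φ h n z x) :
    theta hT Φ h n (Simplicial.cls z hz) = T.hom (n + 1) (skPairIncl h I n) x :=
  congrArg _ ((exists_represents hT Φ h hz).choose_spec.unique hT hx)

theorem theta_mapHom {X A : FilteredSet M V} {h : A.IsSubset X} {Y B : FilteredSet M W}
    {h' : B.IsSubset Y} (f : RF.pair X A h I ⟶ RF.pair Y B h' I) (n : ℤ)
    (x : Simplicial.Homology (RF.pair X A h I) (n + 1)) :
    theta hT Φ h' n (Simplicial.mapHom f (n + 1) x) =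
      T.hom (n + 1) f (theta hT Φ h n x) := by
  obtain ⟨z, hz, rfl⟩ := Simplicial.exists_cls x
  obtain ⟨y, hy⟩ := exists_represents hT Φ h hz
  rw [Simplicial.mapHom_cls, theta_cls hT Φ h hz hy, theta_cls hT Φ h' _ (hy.map f hz),
    hom_hom, hom_hom]
  refine hom_congr (fun _ => ?_) _
  rfl

/-- If `y` represents `z`, then the boundary of `y`, an absolute class of `sk (n + 2) A`, represents
`∂z`. -/
theorem bdHom_theta {X A : FilteredSet M V} (h : A.IsSubset X) (n : ℤ)
    (x : Simplicial.Homology (RF.pair X A h I) (n + 1 + 1)) :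
    T.bdHom (n + 1) (RF.pair X A h I) (theta hT Φ h (n + 1) x) =
      theta hT Φ A.empty_isSubset n (Simplicial.bdHom (RF.pair X A h I) (n + 1) x) := by
  obtain ⟨z, hz, rfl⟩ := Simplicial.exists_cls x
  obtain ⟨y, hy⟩ := exists_represents hT Φ h hz
  have hy' : Represents Φ A.empty_isSubset n (bdry z)
      (T.hom (n + 1) (inclPair _ I) (skPairBd T h I (n + 1) y)) := by
    constructor
    · have e : skPairBd T A.empty_isSubset I n
          (T.hom (n + 1) (inclPair _ I) (skPairBd T h I (n + 1) y)) = 0 :=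
        (exact_hom_bdHom hT _ I n _).2 ⟨_, rfl⟩
      rw [e, bdry_bdry, map_zero, map_zero]
    · rw [skPairToCell_inclPair, hy.bd]
  rw [theta_cls hT Φ h hz hy, Simplicial.bdHom_cls, theta_cls hT Φ A.empty_isSubset _ hy',
    bdHom_hom, hom_hom]
  refine hom_congr (fun _ => ?_) _
  rfl

end Axioms

end Theory

/-! ### The comparison is an isomorphism -/

/-- The augmentation is determined by its value on a vertex. -/
theorem Simplicial.eq_augHom {M : EReal} {V : Type u} {S : FilteredSet M V} {q : ℕ} {α : EReal}
    (hS : S.IsSimplex q α) {I : Interval M} (hα : α ≤ I.lo) {v : V} (hv : v ∈ S.carrier)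
    {ψ : Simplicial.Homology (RF.single S I) 0 →+ ℤ}
    (hψ : ψ (Simplicial.cls _ (Simplicial.vertex_mem_cycles hS hα hv)) = 1) :
    ψ = Simplicial.augHom S I := by
  ext x
  have hx : x = Simplicial.augHom S I x •
      Simplicial.cls _ (Simplicial.vertex_mem_cycles hS hα hv) := by
    apply (Simplicial.augHom_bijective hS hα).1
    rw [map_zsmul, Simplicial.augHom_cls, aug_single, smul_eq_mul, mul_one]
  conv_lhs => rw [hx]
  rw [map_zsmul, hψ, smul_eq_mul, mul_one]

/-- Both groups are infinite cyclic, so it suffices that a generator goes to a generator. The degree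
is a variable `k` because `theta` lives in a degree `n + 1` that equals zero only propositionally.
-/
theorem Simplicial.bijective_of_vertex {M : EReal} {V : Type u} {S : FilteredSet M V} {q : ℕ}
    {α : EReal} (hS : S.IsSimplex q α) {I : Interval M} (hα : α ≤ I.lo) {v : V}
    (hv : v ∈ S.carrier) {k : ℤ} (hk : k = 0) {G : Type*} [AddCommGroup G] (φ : G ≃+ ℤ)
    (θ : Simplicial.Homology (RF.single S I) k →+ G)
    (hz : Finsupp.single [v] 1 ∈ Simplicial.cycles (RF.single S I) k)
    (h : φ (θ (Simplicial.cls _ hz)) = 1) : Function.Bijective θ := by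
  subst hk
  have e : φ.toAddMonoidHom.comp θ = Simplicial.augHom S I := Simplicial.eq_augHom hS hα hv h
  refine (Function.Bijective.of_comp_iff' φ.bijective _).1 ?_
  have e' : φ ∘ θ = Simplicial.augHom S I := congrArg DFunLike.coe e
  rw [e']
  exact Simplicial.augHom_bijective hS hα

namespace Theory

variable {M : EReal} {T : Theory.{u} M} {I : Interval M} {V : Type u}
variable (hT : T.SatisfiesAxioms) (Φ : Fundamental T I)

theorem exists_point_class {S : FilteredSet M V} {q : ℕ} {α : EReal} (hS : S.IsSimplex q α)
    (hα : α ≤ I.lo) {v : V} (hv : S.IsSmall I [v]) {k : ℤ} (hk : k = 0) :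
    ∃ x : (T.H k).obj (RF.single (sk (k + 1) S) I),
      toCell T I S k x = psi S (Φ.cls k) (Finsupp.single [v] 1) ∧
      ∃ φ : (T.H k).obj (RF.single S I) ≃+ ℤ,
        φ (T.hom k (inclSingle (sk_isSubset (k + 1) S) I) x) = 1 := by
  subst hk
  obtain ⟨φ, hφ⟩ := Φ.generates S q α hS hα
  refine ⟨T.hom 0 (vertexHom (sk (0 + 1) S) (hv.sk (by simp))) Φ.gen, ?_, φ, ?_⟩
  · rw [Φ.cls_zero, psi_vertex Φ.gen hv]
  · rw [hom_hom, hφ]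

theorem exists_theta_vertex {S : FilteredSet M V} {q : ℕ} {α : EReal} (hS : S.IsSimplex q α)
    (hα : α ≤ I.lo) {v : V} (hv : S.IsSmall I [v]) {n : ℤ} (hn : n + 1 = 0)
    (hz : Finsupp.single [v] 1 ∈ Simplicial.cycles (RF.single S I) (n + 1)) :
    ∃ φ : (T.H (n + 1)).obj (RF.single S I) ≃+ ℤ,
      φ (theta hT Φ S.empty_isSubset n (Simplicial.cls _ hz)) = 1 := by
  obtain ⟨x, hx, φ, hφ⟩ := exists_point_class Φ hS hα hv hn
  refine ⟨φ, ?_⟩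
  have hx' : Represents Φ S.empty_isSubset n (Finsupp.single [v] 1)
      (T.hom (n + 1) (inclPair _ I) x) := by
    constructor
    · have e : skPairBd T S.empty_isSubset I n (T.hom (n + 1) (inclPair _ I) x) = 0 :=
        (exact_hom_bdHom hT _ I n _).2 ⟨x, rfl⟩
      rw [e, (Simplicial.mem_cycles_single.1 hz).2, map_zero, map_zero]
    · rw [skPairToCell_inclPair, hx]
  rw [theta_cls hT Φ S.empty_isSubset hz hx', hom_hom]
  refine (congrArg φ (hom_congr (fun _ => ?_) x)).trans hφ
  rfl

theorem theta_bijective_of_isSimplex {S : FilteredSet M V} {q : ℕ} {α : EReal}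
    (hS : S.IsSimplex q α) (n : ℤ) :
    Function.Bijective (theta hT Φ S.empty_isSubset n) := by
  by_cases hk : n + 1 = 0 ∧ α ≤ I.lo
  · obtain ⟨hn, hα⟩ := hk
    obtain ⟨v, hv⟩ := Simplicial.exists_mem_of_isSimplex hS
    have hv' : S.IsSmall I [v] :=
      Simplicial.isSmall_of_isSimplex hS hα (by simp) (by simpa using hv)
    have hz : Finsupp.single [v] 1 ∈ Simplicial.cycles (RF.single S I) (n + 1) :=
      hn.symm ▸ Simplicial.vertex_mem_cycles hS hα hv
    obtain ⟨φ, hφ⟩ := exists_theta_vertex hT Φ hS hα hv' hn hz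
    exact Simplicial.bijective_of_vertex hS hα hv hn φ _ hz hφ
  · have h1 := Simplicial.subsingleton_homology hS I hk
    have h2 := (hT.2.2 I).1 V S q α (n + 1) hS hk
    exact ⟨fun _ _ _ => h1.elim _ _, fun y => ⟨0, h2.elim _ _⟩⟩

/-- Five lemma on the long exact sequences, with `(X, A)` in the middle. The shift of `n` makes room
for the lower degree of `A`. -/
theorem theta_pair_bijective {X A : FilteredSet M V} (h : A.IsSubset X)
    (hX : ∀ n, Function.Bijective (theta hT Φ X.empty_isSubset n))
    (hA : ∀ n, Function.Bijective (theta hT Φ A.empty_isSubset n)) (n : ℤ) :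
    Function.Bijective (theta hT Φ h n) := by
  obtain ⟨n, rfl⟩ : ∃ m, n = m + 1 := ⟨n - 1, by omega⟩
  have hS := Simplicial.satisfiesAxioms.{u} (M := M)
  exact AddMonoidHom.bijective_of_surjective_of_bijective_of_bijective_of_injective
    (Simplicial.mapHom (inclSingle h I) (n + 1 + 1)) (Simplicial.mapHom (inclPair h I) (n + 1 + 1))
    (Simplicial.bdHom (RF.pair X A h I) (n + 1)) (Simplicial.mapHom (inclSingle h I) (n + 1))
    (T.hom (n + 1 + 1) (inclSingle h I)) (T.hom (n + 1 + 1) (inclPair h I))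
    (T.bdHom (n + 1) (RF.pair X A h I)) (T.hom (n + 1) (inclSingle h I))
    (theta hT Φ A.empty_isSubset (n + 1)) (theta hT Φ X.empty_isSubset (n + 1))
    (theta hT Φ h (n + 1)) (theta hT Φ A.empty_isSubset n) (theta hT Φ X.empty_isSubset n)
    (AddMonoidHom.ext fun x => (theta_mapHom hT Φ (inclSingle h I) (n + 1) x).symm)
    (AddMonoidHom.ext fun x => (theta_mapHom hT Φ (inclPair h I) (n + 1) x).symm)
    (AddMonoidHom.ext fun x => bdHom_theta hT Φ h n x)
    (AddMonoidHom.ext fun x => (theta_mapHom hT Φ (inclSingle h I) n x).symm)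
    (exact_hom_hom hS h I (n + 1 + 1)) (exact_hom_bdHom hS h I (n + 1))
    (exact_bdHom_hom hS h I (n + 1))
    (exact_hom_hom hT h I (n + 1 + 1)) (exact_hom_bdHom hT h I (n + 1))
    (exact_bdHom_hom hT h I (n + 1))
    (hA _).2 (hX _) (hA _) (hX _).1

/-- The same five lemma, moved one place so that `X` is in the middle. -/
theorem theta_single_bijective {X A : FilteredSet M V} (h : A.IsSubset X)
    (hXA : ∀ n, Function.Bijective (theta hT Φ h n))
    (hA : ∀ n, Function.Bijective (theta hT Φ A.empty_isSubset n)) (n : ℤ) :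
    Function.Bijective (theta hT Φ X.empty_isSubset n) := by
  obtain ⟨n, rfl⟩ : ∃ m, n = m + 1 := ⟨n - 1, by omega⟩
  have hS := Simplicial.satisfiesAxioms.{u} (M := M)
  exact AddMonoidHom.bijective_of_surjective_of_bijective_of_bijective_of_injective
    (Simplicial.bdHom (RF.pair X A h I) (n + 1 + 1))
    (Simplicial.mapHom (inclSingle h I) (n + 1 + 1)) (Simplicial.mapHom (inclPair h I) (n + 1 + 1))
    (Simplicial.bdHom (RF.pair X A h I) (n + 1))
    (T.bdHom (n + 1 + 1) (RF.pair X A h I))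
    (T.hom (n + 1 + 1) (inclSingle h I)) (T.hom (n + 1 + 1) (inclPair h I))
    (T.bdHom (n + 1) (RF.pair X A h I))
    (theta hT Φ h (n + 1 + 1)) (theta hT Φ A.empty_isSubset (n + 1))
    (theta hT Φ X.empty_isSubset (n + 1)) (theta hT Φ h (n + 1)) (theta hT Φ A.empty_isSubset n)
    (AddMonoidHom.ext fun x => bdHom_theta hT Φ h (n + 1) x)
    (AddMonoidHom.ext fun x => (theta_mapHom hT Φ (inclSingle h I) (n + 1) x).symm)
    (AddMonoidHom.ext fun x => (theta_mapHom hT Φ (inclPair h I) (n + 1) x).symm)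
    (AddMonoidHom.ext fun x => bdHom_theta hT Φ h n x)
    (exact_bdHom_hom hS h I (n + 1 + 1)) (exact_hom_hom hS h I (n + 1 + 1))
    (exact_hom_bdHom hS h I (n + 1))
    (exact_bdHom_hom hT h I (n + 1 + 1)) (exact_hom_hom hT h I (n + 1 + 1))
    (exact_hom_bdHom hT h I (n + 1))
    (hXA _).2 (hA _) (hXA _) (hA _).1

theorem theta_bijective_single (X : FilteredSet M V) (n : ℤ) :
    Function.Bijective (theta hT Φ X.empty_isSubset n) := by
  induction X using cell_induction generalizing n with
  | hempty =>
    have h1 := subsingleton_empty (V := V) (Simplicial.satisfiesAxioms.{u} (M := M)) I (n + 1)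
    have h2 := subsingleton_empty (V := V) hT I (n + 1)
    exact ⟨fun _ _ _ => h1.elim _ _, fun y => ⟨0, h2.elim _ _⟩⟩
  | hsimplex S q α hS => exact theta_bijective_of_isSimplex hT Φ hS n
  | hunion S Y q α hS _ hY hSY =>
    refine theta_single_bijective hT Φ (S.isSubset_union_right Y) (fun k => ?_) hY n
    have h1 := theta_pair_bijective hT Φ (S.inter_isSubset_left Y)
      (theta_bijective_of_isSimplex hT Φ hS) hSY k
    have h2 := excision_bijective (Simplicial.satisfiesAxioms.{u} (M := M)) I S Y (k + 1)
    have h3 := excision_bijective hT I S Y (k + 1)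
    refine (Function.Bijective.of_comp_iff _ h2).1 ?_
    refine Eq.mp (congrArg Function.Bijective ?_) (h3.comp h1)
    funext x
    exact (theta_mapHom hT Φ _ k x).symm

/-- The comparison map is an isomorphism. -/
theorem theta_bijective {X A : FilteredSet M V} (h : A.IsSubset X) (n : ℤ) :
    Function.Bijective (theta hT Φ h n) :=
  theta_pair_bijective hT Φ h (theta_bijective_single hT Φ X) (theta_bijective_single hT Φ A) n

/-- The comparison isomorphism in degree `n + 1`. -/
def thetaIso (Φ : ∀ I, Fundamental T I) (n : ℤ) :
    (Simplicial.theory M).H (n + 1) ≅ T.H (n + 1) :=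
  NatIso.ofComponents
    (fun P => AddEquiv.toAddCommGrpIso (X := AddCommGrpCat.of (Simplicial.Homology P (n + 1)))
      (AddEquiv.ofBijective (theta hT (Φ P.I) P.sub n) (theta_bijective hT (Φ P.I) P.sub n)))
    (fun {P Q} f => by
      obtain ⟨V, X, A, h, I⟩ := P
      obtain ⟨W, Y, B, h', J⟩ := Q
      obtain rfl : I = J := RF.Hom.interval_eq f
      ext x
      exact theta_mapHom hT (Φ I) f n x)

/-- A family on the integers given by its members at the successors. -/
def ofSucc {F : ℤ → Type*} (g : ∀ n, F (n + 1)) (k : ℤ) : F k :=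
  (sub_add_cancel k 1) ▸ g (k - 1)

theorem ofSucc_succ {F : ℤ → Type*} (g : ∀ n, F (n + 1)) (n : ℤ) : ofSucc g (n + 1) = g n := by
  have : ∀ (m : ℤ) (h : m + 1 = n + 1), h ▸ g m = g n := by
    intro m h
    obtain rfl : m = n := by omega
    rfl
  exact this _ _

/-- Every theory that satisfies the axioms is isomorphic to simplicial homology. -/
theorem isIsomorphic_simplicial (hT : T.SatisfiesAxioms) :
    (Simplicial.theory M).IsIsomorphic T := by
  let Φ : ∀ I, Fundamental T I := fun I => (exists_fundamental hT I).some
  refine ⟨ofSucc (F := fun n => (Simplicial.theory M).H n ≅ T.H n) (thetaIso hT Φ), fun n P => ?_⟩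
  obtain ⟨n, rfl⟩ : ∃ m, n = m + 1 := ⟨n - 1, by omega⟩
  rw [ofSucc_succ, ofSucc_succ]
  ext x
  exact (bdHom_theta hT (Φ P.I) P.sub n x).symm

theorem IsIsomorphic.symm {T T' : Theory.{u} M} (h : T.IsIsomorphic T') : T'.IsIsomorphic T := by
  obtain ⟨e, he⟩ := h
  refine ⟨fun n => (e n).symm, fun n P => ?_⟩
  rw [Iso.symm_hom, Iso.symm_hom, ← cancel_epi ((e (n + 1)).hom.app P), Iso.hom_inv_id_app_assoc,
    ← Category.assoc, ← he n P, Category.assoc, Iso.hom_inv_id_app]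
  exact Category.comp_id _

theorem IsIsomorphic.trans {T T' T'' : Theory.{u} M} (h : T.IsIsomorphic T')
    (h' : T'.IsIsomorphic T'') : T.IsIsomorphic T'' := by
  obtain ⟨e, he⟩ := h
  obtain ⟨e', he'⟩ := h'
  refine ⟨fun n => e n ≪≫ e' n, fun n P => ?_⟩
  rw [Iso.trans_hom, Iso.trans_hom, NatTrans.comp_app, NatTrans.comp_app, Category.assoc,
    ← he' n P, ← Category.assoc, he n P, Category.assoc]

end Theory

end PersistentHomology

end

theorem mainTheorem3 (M : EReal) :
    (∃ T : PersistentHomology.Theory.{u} M, T.SatisfiesAxioms) ∧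
      ∀ T T' : PersistentHomology.Theory.{u} M,
        T.SatisfiesAxioms → T'.SatisfiesAxioms → T.IsIsomorphic T' :=
  ⟨⟨_, PersistentHomology.Simplicial.satisfiesAxioms⟩, fun _ _ hT hT' =>
    (PersistentHomology.Theory.isIsomorphic_simplicial hT).symm.trans
      (PersistentHomology.Theory.isIsomorphic_simplicial hT')⟩
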